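/- Let $\mathcal S$ be a finite set, let $T=[T_{ij}]_{i,j\in\mathcal S}$ be the generator of an irreducible continuous-time Markov chain $\varphi(\cdot)$ on $\mathcal S$, and let $c_i,r_i$ ($i\in\mathcal S$) be nonzero real numbers. Let $X(t)\ge 0$ be the fluid level driven by $\varphi$: $X$ is continuous, $dX(t)/dt=c_{\varphi(t)}$ when $X(t)>0$ and $dX(t)/dt=\max\{0,c_{\varphi(t)}\}$ when $X(t)=0$. Let $\omega(y)=\inf\{t>0:\int_0^t|r_{\varphi(u)}|\,du=y\}$ be the first time at which the total in-out fluid with rates $|r_i|$ reaches $y$. Write $R=\mathrm{diag}(r_i)$, $|R|=\mathrm{diag}(|r_i|)$, $C=\mathrm{diag}(c_i)$, $\mathcal S_+=\{j:c_j>0\}$, $\mathcal S_-=\{j:c_j<0\}$; a subscript $+$ or $-$ on a vector or matrix denotes the corresponding sub-vector or block. All vectors are row vectors. For a family $\mu=[\mu_j]_{j\in\mathcal S}$ of signed measures on $[0,\infty)$ with densities $\nu_j(x)$, $x>0$, and atoms $P_j$ at $0$, put $\mathcal A_v=[0,v]$ and define $\mu D=[(\mu D)_j]_{j\in\mathcal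 S}$ for $v>0$ by $$(\mu D)_j(\mathcal A_v)=\sum_{i\in\mathcal S}\frac{1}{|r_i|}T_{ij}\,\mu_i(\mathcal A_v)-\frac{c_j}{|r_j|}\,\nu_j(v).$$ For $n\ge 0$ let ${}_{D^n}\nu$ and ${}_{D^n}P$ be the density on $(0,\infty)$ and the atom at $0$ of $\mu D^n$, and let ${}_{D^n}\nu(0)=\lim_{x\to0+}{}_{D^n}\nu(x)$. Suppose that the initial law $\mu_i(A)=\mathbb P(\varphi(0)=i,\,X(0)\in A)$ has the density $\nu_i(x)=p_i\lambda e^{-\lambda x}$ on $(0,\infty)$, with $\lambda>0$ and $0\le p_i\le1$, and an atom $P_i\ge0$ at $0$, where $P_i=0$ for $i\in\mathcal S_+$ (given $\varphi(0)$, the process $\varphi$ is independent of $X(0)$). Suppose that for all $n\ge0$ the boundary condition $${}_{D^n}\nu_+(0)={}_{D^n}P_-\,\big(|R_-|^{-1}T_{-+}\big)\big(|R_+|^{-1}C_+\big)^{-1}$$ holds. Let $\nu(0)=[p_i\lambda]_{i\in\mathcal S}$. Then for every $v>0$, $$\mu((v,\infty))=\int_0^\infty\nu(x)\,dx-\int_0^v\nu(x)\,dx=e^{-\lambda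 v}\,\frac{\nu(0)}{\lambda},$$ and for all $y>0$ and $v>0$ the series $\mu e^{Dy}(\mathcal A_v)=\sum_{n\ge0}\frac{y^n}{n!}\,\mu D^n(\mathcal A_v)$ converges and $$\mu e^{Dy}(\mathcal A_v)=-\mu((v,\infty))\,e^{(|R|^{-1}T+\lambda|R|^{-1}C)y}+\mu([0,\infty))\,e^{(|R|^{-1}T)y};$$ moreover, this vector is the joint law of the phase and the level at time $\omega(y)$: $$[\mu e^{Dy}(\mathcal A_v)]_j=\mathbb P\big(\varphi(\omega(y))=j,\ X(\omega(y))\le v\big)\qquad(j\in\mathcal S).$$ -/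

import Mathlib

open MeasureTheory ProbabilityTheory Filter Topology Set
open scoped BigOperators ENNReal Matrix

noncomputable section

namespace FluidFluid

variable {S : Type*} [Fintype S] [DecidableEq S]

/-! ### The phase process -/

/-- `T` is the generator (rate matrix) of a continuous-time Markov chain on the finite set `S`. -/
def IsGenerator (T : Matrix S S ℝ) : Prop :=
  (∀ i j, i ≠ j → 0 ≤ T i j) ∧ ∀ i, ∑ j, T i j = 0

/-- Every phase can be reached from every other phase through transitions of positive rate. -/
def IsIrreducibleGenerator (T : Matrix S S ℝ) : Prop :=
  ∀ i j, Relation.ReflTransGen (fun a b => a ≠ b ∧ 0 < T a b) i j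

/-- Transition matrix of the embedded jump chain of the generator `T`
(a phase with zero exit rate is absorbing). -/
def jumpMatrix (T : Matrix S S ℝ) : Matrix S S ℝ := fun i j =>
  if T i i = 0 then (if i = j then 1 else 0)
  else if i = j then 0 else T i j / (-T i i)

/-- The time of the `n`-th jump along one path with visited phases `J` and normalised holding
times `E`: the holding time in the `k`-th visited phase is `E k` divided by the exit rate of that
phase (it is infinite when the exit rate is zero). -/
def jumpTime (T : Matrix S S ℝ) (J : ℕ → S) (E : ℕ → ℝ) (n : ℕ) : ℝ≥0∞ :=
  ∑ k ∈ Finset.range n, ENNReal.ofReal (E k) / ENNReal.ofReal (-T (J k) (J k))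

/-- `φ` is (almost surely) a right-continuous continuous-time Markov chain with generator `T`,
whose evolution depends on the additional initial variable `ξ` through `φ 0` only.
This is the definition by jump chain and holding times: the visited phases `J` form
a discrete-time Markov chain with transition matrix `jumpMatrix T`, the variables `E` are
independent, exponential with mean one and independent of `(ξ, J)`, and `φ` stays in `J n` between
the `n`-th and the `(n+1)`-st jump time. -/
def IsCTMC {Ω : Type*} [MeasurableSpace Ω] (Pr : Measure Ω) (T : Matrix S S ℝ)
    (ξ : Ω → ℝ) (φ : ℝ → Ω → S) : Prop :=
  ∃ (J : ℕ → Ω → S) (E : ℕ → Ω → ℝ),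
    (∀ n i, MeasurableSet {ω | J n ω = i}) ∧
    (∀ n, Measurable (E n)) ∧
    (∀ (n : ℕ) (s : ℕ → S) (A : Set ℝ) (B : ℕ → Set ℝ), MeasurableSet A →
      (∀ k, MeasurableSet (B k)) →
      Pr {ω | ξ ω ∈ A ∧ (∀ k ≤ n, J k ω = s k) ∧ ∀ k ≤ n, E k ω ∈ B k} =
        Pr {ω | ξ ω ∈ A ∧ J 0 ω = s 0} *
          (∏ k ∈ Finset.range n, ENNReal.ofReal (jumpMatrix T (s k) (s (k + 1)))) *
          ∏ k ∈ Finset.range (n + 1), expMeasure 1 (B k)) ∧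
    (∀ᵐ ω ∂Pr, ∀ (n : ℕ) (t : ℝ), 0 ≤ t →
      jumpTime T (fun k => J k ω) (fun k => E k ω) n ≤ ENNReal.ofReal t →
      ENNReal.ofReal t < jumpTime T (fun k => J k ω) (fun k => E k ω) (n + 1) →
      φ t ω = J n ω)

/-! ### The fluid level and the in-out fluid -/

/-- Along one path `φ` of the phase, `X` is a fluid level bounded below by `0`: it is continuous,
nonnegative, and has rate of change `c (φ t)` while `X t > 0` and `max 0 (c (φ t))` while
`X t = 0` (in integrated form, as the rate jumps with the phase). -/
def IsFluidLevel (c : S → ℝ) (φ : ℝ → S) (X : ℝ → ℝ) : Prop :=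
  ContinuousOn X (Ici 0) ∧ (∀ t, 0 ≤ t → 0 ≤ X t) ∧
    ∀ t, 0 ≤ t →
      X t = X 0 + ∫ u in (0 : ℝ)..t, (if 0 < X u then c (φ u) else max 0 (c (φ u)))

/-- The first time at which the in-out fluid `∫₀ᵗ |r (φ u)| du` equals `y`. -/
def inOutTime (r : S → ℝ) (φ : ℝ → S) (y : ℝ) : ℝ :=
  sInf {t : ℝ | 0 < t ∧ ∫ u in (0 : ℝ)..t, |r (φ u)| = y}

/-! ### Initial distribution -/

/-- The exponential density `ν i x = p i * lam * exp (-lam * x)`. -/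
def expDensity (lam : ℝ) (p : S → ℝ) (i : S) (x : ℝ) : ℝ :=
  p i * lam * Real.exp (-lam * x)

/-- The measure on the line, concentrated on `[0, ∞)`, with density `expDensity lam p i` on
`(0, ∞)` and an atom `P i` at `0`. -/
def initialMeasure (lam : ℝ) (p P : S → ℝ) (i : S) : Measure ℝ :=
  (volume.restrict (Ioi 0)).withDensity (fun x => ENNReal.ofReal (expDensity lam p i x)) +
    ENNReal.ofReal (P i) • Measure.dirac 0

/-! ### The operators `B` and `D`

A family of (signed) measures `m j` on `[0, ∞)`, `j ∈ S`, with a density on `(0, ∞)` and an atom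
at `0` is represented by the functions `F j v = m j [0, v]`, `v > 0`. Its density at `x > 0` is
the derivative of `F j` at `x` and its atom is the limit of `F j` at `0` from the right. -/

/-- `(m_i B_ij)[0, v]`, where `B` is the generator with respect to time. -/
def opB (T : Matrix S S ℝ) (c : S → ℝ) (F : S → ℝ → ℝ) (i j : S) (v : ℝ) : ℝ :=
  if i = j then T j j * F j v - c j * deriv (F j) v else T i j * F i v

/-- `(m D)_j [0, v] = ∑ i, (m_i D_ij)[0, v]` with `D_ij = B_ij / |r i|`, the generator with
respect to the level of the in-out fluid. -/
def opD (T : Matrix S S ℝ) (c r : S → ℝ) (F : S → ℝ → ℝ) : S → ℝ → ℝ :=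
  fun j v => ∑ i, 1 / |r i| * opB T c F i j v

/-- The boundary condition for a family of measures with distribution functions `F`: if `ν0` is
the limit of the density at `0` from the right and `P` is the atom at `0`, then
`ν0_+ = P_- (|R_-|⁻¹ T_{-+}) (|R_+|⁻¹ C_+)⁻¹`. -/
def BoundaryCondition (T : Matrix S S ℝ) (c r : S → ℝ) (F : S → ℝ → ℝ) : Prop :=
  ∃ ν0 P : S → ℝ,
    (∀ j, Tendsto (deriv (F j)) (𝓝[>] 0) (𝓝 (ν0 j))) ∧
    (∀ j, Tendsto (F j) (𝓝[>] 0) (𝓝 (P j))) ∧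
    ∀ j, 0 < c j →
      ν0 j = (∑ i ∈ Finset.univ.filter (fun i => c i < 0), P i * (T i j / |r i|)) *
        (c j / |r j|)⁻¹

/-! ### The matrices of the formula -/

/-- The fluid generator `|R|⁻¹ T`. -/
def fluidGenerator (T : Matrix S S ℝ) (r : S → ℝ) : Matrix S S ℝ :=
  (Matrix.diagonal fun i => |r i|)⁻¹ * T

/-- The matrix `|R|⁻¹ C`. -/
def scaledDrift (c r : S → ℝ) : Matrix S S ℝ :=
  (Matrix.diagonal fun i => |r i|)⁻¹ * Matrix.diagonal c

/-- The row vector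
`- μ((v,∞)) exp((|R|⁻¹ T + lam |R|⁻¹ C) y) + μ([0,∞)) exp((|R|⁻¹ T) y)`. -/
def lawFormula (T : Matrix S S ℝ) (c r : S → ℝ) (lam : ℝ) (μ : S → Measure ℝ) (y v : ℝ) :
    S → ℝ :=
  -((fun i => (μ i).real (Ioi v)) ᵥ*
      NormedSpace.exp (y • (fluidGenerator T r + lam • scaledDrift c r))) +
    (fun i => (μ i).real (Ici 0)) ᵥ* NormedSpace.exp (y • fluidGenerator T r)

end FluidFluid

end

/-!
Measured in in-out fluid instead of time, the phase is a Markov chain with generator `G = |R|⁻¹ T`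
and the level moves with drift `κ = c / |r|`, reflected at `0`. With `a = p + P` and `b = p`, the
initial distribution functions are `a - exp (-lam v) b`. The operator `D` keeps this form, acting on
`a` by `G` and on `b` by `G + lam K`, `K = diagonal κ` (`opD_iterate_exponential`); summing the
exponential series gives the closed formula `levelLaw` (`hasSum_opD_iterate`). The boundary
conditions say inductively that the atoms at `0` of all `m D^n` vanish in the up-phases
(`atom_opD_iterate_eq_zero`), hence so does the atom of the closed formula
(`levelLaw_zero_eq_zero`).

The closed formula is identified with the law of the process through the forward equation obtained
by conditioning on the last jump. Along a characteristic `s ↦ v - κ j (y - s)` the formula satisfies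
a linear differential equation, and characteristics of up-phases start either at in-out fluid `0` or
at level `0`, where there is no atom; so the formula solves the integral equation
(`levelCdf_forward_equation`). On the other side, the Markov property of the jump chain
(`IsMarkedChain.restart`) shows that the probabilities `stayProb n` of being in the `n`-th visited
phase with level at most `v` are the successive iterates of the same integral operator
(`stayProb_succ`). The difference between the formula and the first `N` of these terms is thus the
`N`-th iterate of a Volterra operator on a bounded function, hence `O((Γ y)^N / N!)`
(`hasSum_forward_iterates`).

Finally, a pathwise computation (`phase_level_at_inOutTime`) identifies the phase and the level at
`inOutTime` on each of these events. The events cover almost every path because the total mass of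
the formula is `1` (`measureReal_eq_levelCdf`), so that non-explosion comes for free. If some phase
is absorbing, irreducibility leaves only this phase, and there is only one event.
-/

namespace FluidFluid

section

variable {S : Type*} [Fintype S] [DecidableEq S]

/-! ### Matrix exponentials acting on row vectors -/

theorem fluidGenerator_apply (T : Matrix S S ℝ) {r : S → ℝ} (hr : ∀ i, r i ≠ 0) (i j : S) :
    fluidGenerator T r i j = T i j / |r i| := by
  have hu : IsUnit (fun i => |r i|) :=
    Pi.isUnit_iff.2 fun i => (abs_pos.2 (hr i)).ne'.isUnit
  have hinv : Ring.inverse (fun i => |r i|) = fun i => |r i|⁻¹ := by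
    have h1 : (fun i => |r i|) * (fun i => |r i|⁻¹) = 1 := by
      funext i
      simp [hr i]
    rw [← Ring.inverse_mul_cancel_left _ (fun i => |r i|⁻¹) hu, h1, mul_one]
  rw [fluidGenerator, Matrix.inv_diagonal, hinv, Matrix.diagonal_mul]
  ring

theorem scaledDrift_eq (c : S → ℝ) {r : S → ℝ} (hr : ∀ i, r i ≠ 0) :
    scaledDrift c r = Matrix.diagonal fun i => c i / |r i| := by
  have h : scaledDrift c r = fluidGenerator (Matrix.diagonal c) r := rfl
  ext i j
  rw [h, fluidGenerator_apply _ hr, Matrix.diagonal_apply, Matrix.diagonal_apply]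
  split_ifs <;> simp

theorem vecMul_apply {S : Type*} [Fintype S] (w : S → ℝ) (M : Matrix S S ℝ) (j : S) :
    (w ᵥ* M) j = ∑ i, w i * M i j :=
  rfl

theorem hasDerivAt_vecMul_exp_smul (a : S → ℝ) (M : Matrix S S ℝ) (y : ℝ) (j : S) :
    HasDerivAt (fun u : ℝ => (a ᵥ* NormedSpace.exp (u • M)) j)
      (((a ᵥ* NormedSpace.exp (y • M)) ᵥ* M) j) y := by
  open scoped Matrix.Norms.Operator in
  have h := hasDerivAt_exp_smul_const (𝕂 := ℝ) M y
  let ℓ : Matrix S S ℝ →L[ℝ] ℝ := LinearMap.toContinuousLinearMap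
    { toFun := fun N => (a ᵥ* N) j
      map_add' := fun N N' => by simp [Matrix.vecMul_add]
      map_smul' := fun t N => by simp [Matrix.vecMul_smul] }
  have h2 := ℓ.hasFDerivAt.comp_hasDerivAt y h
  rw [Matrix.vecMul_vecMul]
  exact h2

theorem hasSum_vecMul_pow (a : S → ℝ) (M : Matrix S S ℝ) (y : ℝ) (j : S) :
    HasSum (fun n : ℕ => y ^ n / (n.factorial : ℝ) * (a ᵥ* M ^ n) j)
      ((a ᵥ* NormedSpace.exp (y • M)) j) := by
  open scoped Matrix.Norms.Operator in
  have h := NormedSpace.exp_series_hasSum_exp' (𝕂 := ℝ) (y • M)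
  let ℓ : Matrix S S ℝ →L[ℝ] ℝ := LinearMap.toContinuousLinearMap
    { toFun := fun N => (a ᵥ* N) j
      map_add' := fun N N' => by simp [Matrix.vecMul_add]
      map_smul' := fun t N => by simp [Matrix.vecMul_smul] }
  have h2 := ℓ.hasSum h
  refine (congrArg (HasSum · _) (funext fun n => ?_)).mpr h2
  change _ = (a ᵥ* ((n.factorial : ℝ)⁻¹ • (y • M) ^ n)) j
  rw [smul_pow, Matrix.vecMul_smul, Matrix.vecMul_smul]
  simp only [Pi.smul_apply, smul_eq_mul]
  ring

/-- A conservative rate matrix preserves the total mass of a row vector. -/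
theorem sum_vecMul_exp_smul {G : Matrix S S ℝ} (hG : ∀ i, ∑ j, G i j = 0) (a : S → ℝ) (y : ℝ) :
    ∑ j, (a ᵥ* NormedSpace.exp (y • G)) j = ∑ j, a j := by
  have key : ∀ w : S → ℝ, ∑ j, (w ᵥ* G) j = 0 := fun w => by
    simp only [Matrix.vecMul, dotProduct]
    rw [Finset.sum_comm]
    simp [← Finset.mul_sum, hG]
  have h : ∀ t, HasDerivAt (fun u : ℝ => ∑ j, (a ᵥ* NormedSpace.exp (u • G)) j) 0 t := fun t => by
    have := HasDerivAt.fun_sum (u := Finset.univ)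
      fun j _ => hasDerivAt_vecMul_exp_smul a G t j
    rwa [key] at this
  have := is_const_of_deriv_eq_zero (fun t => (h t).differentiableAt) (fun t => (h t).deriv) y 0
  simpa using this

/-! ### The iterates of `D` on exponential families -/

/-- `D` keeps the form `a - exp (-lam v) b`: it multiplies `a` by `|R|⁻¹ T` and `b` by
`|R|⁻¹ T + lam |R|⁻¹ C`. -/
theorem opD_iterate_exponential (T : Matrix S S ℝ) (c : S → ℝ) {r : S → ℝ} (hr : ∀ i, r i ≠ 0)
    (lam : ℝ) (a b : S → ℝ) {F : S → ℝ → ℝ}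
    (hF : ∀ j v, 0 < v → F j v = a j - Real.exp (-lam * v) * b j) (n : ℕ) (j : S) {v : ℝ}
    (hv : 0 < v) :
    (opD T c r)^[n] F j v = (a ᵥ* fluidGenerator T r ^ n) j -
      Real.exp (-lam * v) * (b ᵥ* (fluidGenerator T r + lam • scaledDrift c r) ^ n) j := by
  induction n generalizing j v with
  | zero => simpa using hF j v hv
  | succ n ih =>
    rw [Function.iterate_succ_apply']
    set a' := a ᵥ* fluidGenerator T r ^ n
    set b' := b ᵥ* (fluidGenerator T r + lam • scaledDrift c r) ^ n
    have hder : deriv ((opD T c r)^[n] F j) v = lam * Real.exp (-lam * v) * b' j := by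
      have he : (opD T c r)^[n] F j =ᶠ[𝓝 v] fun w => a' j - Real.exp (-lam * w) * b' j := by
        filter_upwards [Ioi_mem_nhds hv] with w hw using ih j hw
      rw [he.deriv_eq]
      have h1 : HasDerivAt (fun w : ℝ => Real.exp (-lam * w))
          (Real.exp (-lam * v) * (-lam * 1)) v :=
        ((hasDerivAt_id v).const_mul (-lam)).exp
      have h2 := (h1.mul_const (b' j)).const_sub (a' j)
      rw [h2.deriv]
      ring
    have hterm : ∀ i, 1 / |r i| * opB T c ((opD T c r)^[n] F) i j v =
        (a' i * fluidGenerator T r i j - Real.exp (-lam * v) * (b' i * fluidGenerator T r i j)) -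
          (if i = j then Real.exp (-lam * v) * (b' j * (lam * (c j / |r j|))) else 0) := by
      intro i
      rw [opB, ih i hv, fluidGenerator_apply T hr]
      split_ifs with h
      · subst h
        rw [hder, ih i hv]
        ring
      · ring
    rw [opD, Finset.sum_congr rfl fun i _ => hterm i, Finset.sum_sub_distrib,
      Finset.sum_sub_distrib, Finset.sum_ite_eq', ← Finset.mul_sum, pow_succ, pow_succ,
      ← Matrix.vecMul_vecMul, ← Matrix.vecMul_vecMul]
    change _ = (a' ᵥ* _) j - Real.exp (-lam * v) * (b' ᵥ* _) j
    rw [Matrix.vecMul_add, Matrix.vecMul_smul, scaledDrift_eq c hr, Pi.add_apply, Pi.smul_apply,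
      Matrix.vecMul_diagonal, vecMul_apply, vecMul_apply]
    simp only [Finset.mem_univ, if_true, smul_eq_mul]
    ring

/-- The row vector `a exp (y G) - exp (-lam v) b exp (y (G + lam K))`, `K = diagonal κ`: the
candidate for the joint law of the phase and of a level at most `v`, at in-out fluid `y`. -/
noncomputable def levelLaw (G : Matrix S S ℝ) (κ : S → ℝ) (lam : ℝ) (a b : S → ℝ) (y : ℝ) (j : S)
    (v : ℝ) : ℝ :=
  (a ᵥ* NormedSpace.exp (y • G)) j -
    Real.exp (-lam * v) * (b ᵥ* NormedSpace.exp (y • (G + lam • Matrix.diagonal κ))) j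

theorem hasSum_opD_iterate (T : Matrix S S ℝ) (c : S → ℝ) {r : S → ℝ} (hr : ∀ i, r i ≠ 0)
    (lam : ℝ) (a b : S → ℝ) {F : S → ℝ → ℝ}
    (hF : ∀ j v, 0 < v → F j v = a j - Real.exp (-lam * v) * b j) (y : ℝ) (j : S) {v : ℝ}
    (hv : 0 < v) :
    HasSum (fun n : ℕ => y ^ n / (n.factorial : ℝ) * (opD T c r)^[n] F j v)
      (levelLaw (fluidGenerator T r) (fun i => c i / |r i|) lam a b y j v) := by
  have h1 := hasSum_vecMul_pow a (fluidGenerator T r) y j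
  have h2 := hasSum_vecMul_pow b (fluidGenerator T r + lam • scaledDrift c r) y j
  have h := h1.sub (h2.mul_left (Real.exp (-lam * v)))
  rw [levelLaw, ← scaledDrift_eq c hr]
  refine (congrArg (HasSum · _) (funext fun n => ?_)).mpr h
  rw [opD_iterate_exponential T c hr lam a b hF n j hv]
  ring

/-- The boundary condition says that the atom at `0` of `m D^(n+1)` vanishes in every up-phase as
soon as that of `m D^n` does. -/
theorem atom_opD_iterate_eq_zero (T : Matrix S S ℝ) {c r : S → ℝ} (hc : ∀ i, c i ≠ 0)
    (hr : ∀ i, r i ≠ 0) (lam : ℝ) (a b : S → ℝ) {F : S → ℝ → ℝ}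
    (hF : ∀ j v, 0 < v → F j v = a j - Real.exp (-lam * v) * b j)
    (hbc : ∀ n : ℕ, BoundaryCondition T c r ((opD T c r)^[n] F))
    (hab : ∀ j, 0 < c j → a j = b j) (n : ℕ) {j : S} (hj : 0 < c j) :
    (a ᵥ* fluidGenerator T r ^ n) j =
      (b ᵥ* (fluidGenerator T r + lam • scaledDrift c r) ^ n) j := by
  induction n generalizing j with
  | zero => simpa using hab j hj
  | succ n ih =>
    obtain ⟨ν0, Q, hν, hQ, h⟩ := hbc n
    have hform := fun j v hv => opD_iterate_exponential T c hr lam a b hF n j (v := v) hv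
    set a' := a ᵥ* fluidGenerator T r ^ n
    set b' := b ᵥ* (fluidGenerator T r + lam • scaledDrift c r) ^ n
    have hexp : Tendsto (fun v : ℝ => Real.exp (-lam * v)) (𝓝[>] 0) (𝓝 1) := by
      have : Continuous fun v : ℝ => Real.exp (-lam * v) := by fun_prop
      simpa using (this.tendsto 0).mono_left nhdsWithin_le_nhds
    have hQ' : ∀ j, Q j = a' j - b' j := by
      intro j
      have h1 : Tendsto (fun v : ℝ => a' j - Real.exp (-lam * v) * b' j) (𝓝[>] 0)
          (𝓝 (a' j - 1 * b' j)) := (hexp.mul_const _).const_sub _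
      rw [one_mul] at h1
      refine tendsto_nhds_unique (hQ j) (h1.congr' ?_)
      filter_upwards [self_mem_nhdsWithin] with v hv using (hform j v hv).symm
    have hν' : ∀ j, ν0 j = lam * b' j := by
      intro j
      have h1 : Tendsto (fun v : ℝ => lam * Real.exp (-lam * v) * b' j) (𝓝[>] 0)
          (𝓝 (lam * 1 * b' j)) := (hexp.const_mul _).mul_const _
      rw [mul_one] at h1
      refine tendsto_nhds_unique (hν j) (h1.congr' ?_)
      filter_upwards [self_mem_nhdsWithin] with v hv
      have he : (opD T c r)^[n] F j =ᶠ[𝓝 v] fun w => a' j - Real.exp (-lam * w) * b' j := by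
        filter_upwards [Ioi_mem_nhds hv] with w hw using hform j w hw
      rw [he.deriv_eq]
      have h1 : HasDerivAt (fun w : ℝ => Real.exp (-lam * w))
          (Real.exp (-lam * v) * (-lam * 1)) v :=
        ((hasDerivAt_id v).const_mul (-lam)).exp
      have h2 := (h1.mul_const (b' j)).const_sub (a' j)
      rw [h2.deriv]
      ring
    have hj' := h j hj
    have hsum : ∑ i ∈ Finset.univ.filter (fun i => c i < 0), Q i * (T i j / |r i|) =
        ∑ i, (a' i - b' i) * fluidGenerator T r i j := by
      rw [Finset.sum_filter]
      refine Finset.sum_congr rfl fun i _ => ?_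
      rw [fluidGenerator_apply T hr, hQ']
      split_ifs with hi
      · rfl
      · rw [ih (lt_of_le_of_ne (not_lt.1 hi) (hc i).symm)]
        simp
    have hne : c j / |r j| ≠ 0 := div_ne_zero (hc j) (abs_pos.2 (hr j)).ne'
    rw [hsum, hν', eq_mul_inv_iff_mul_eq₀ hne] at hj'
    rw [pow_succ, pow_succ, ← Matrix.vecMul_vecMul, ← Matrix.vecMul_vecMul]
    change (a' ᵥ* _) j = (b' ᵥ* _) j
    rw [Matrix.vecMul_add, Matrix.vecMul_smul, scaledDrift_eq c hr, Pi.add_apply, Pi.smul_apply,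
      Matrix.vecMul_diagonal, vecMul_apply, vecMul_apply]
    simp only [sub_mul, Finset.sum_sub_distrib] at hj'
    simp only [smul_eq_mul]
    linarith

theorem levelLaw_zero_eq_zero (T : Matrix S S ℝ) {c r : S → ℝ} (hc : ∀ i, c i ≠ 0)
    (hr : ∀ i, r i ≠ 0) (lam : ℝ) (a b : S → ℝ) {F : S → ℝ → ℝ}
    (hF : ∀ j v, 0 < v → F j v = a j - Real.exp (-lam * v) * b j)
    (hbc : ∀ n : ℕ, BoundaryCondition T c r ((opD T c r)^[n] F))
    (hab : ∀ j, 0 < c j → a j = b j) (y : ℝ) {j : S} (hj : 0 < c j) :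
    levelLaw (fluidGenerator T r) (fun i => c i / |r i|) lam a b y j 0 = 0 := by
  have h1 := hasSum_vecMul_pow a (fluidGenerator T r) y j
  have h2 := hasSum_vecMul_pow b (fluidGenerator T r + lam • scaledDrift c r) y j
  rw [levelLaw, ← scaledDrift_eq c hr, mul_zero, Real.exp_zero, one_mul, sub_eq_zero]
  refine h1.unique ((congrArg (HasSum · _) (funext fun n => ?_)).mpr h2)
  simp only [atom_opD_iterate_eq_zero T hc hr lam a b hF hbc hab n hj]

theorem continuous_vecMul_exp_smul (a : S → ℝ) (M : Matrix S S ℝ) (j : S) :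
    Continuous fun u : ℝ => (a ᵥ* NormedSpace.exp (u • M)) j :=
  continuous_iff_continuousAt.2 fun y => (hasDerivAt_vecMul_exp_smul a M y j).continuousAt

theorem continuous_levelLaw (G : Matrix S S ℝ) (κ : S → ℝ) (lam : ℝ) (a b : S → ℝ) (j : S) :
    Continuous fun q : ℝ × ℝ => levelLaw G κ lam a b q.1 j q.2 := by
  have h1 := continuous_vecMul_exp_smul a G j
  have h2 := continuous_vecMul_exp_smul b (G + lam • Matrix.diagonal κ) j
  exact (h1.comp continuous_fst).sub
    ((by fun_prop : Continuous fun q : ℝ × ℝ => Real.exp (-lam * q.2)).mul (h2.comp continuous_fst))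

/-! ### The forward integral equation for the closed formula -/

/-- Along a characteristic `s ↦ v - κ j (y - s)`, the closed formula solves the linear equation
of the phase `j` with killing rate `-G j j` and source `∑ i ≠ j, G i j`. -/
theorem hasDerivAt_levelLaw_characteristic (G : Matrix S S ℝ) (κ : S → ℝ) (lam : ℝ)
    (a b : S → ℝ) (j : S) (y v s : ℝ) :
    HasDerivAt (fun s => Real.exp (G j j * (y - s)) *
        levelLaw G κ lam a b s j (v - κ j * (y - s)))
      (Real.exp (G j j * (y - s)) * ∑ i ∈ Finset.univ.erase j,
        G i j * levelLaw G κ lam a b s i (v - κ j * (y - s))) s := by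
  have hA := hasDerivAt_vecMul_exp_smul a G s j
  have hB := hasDerivAt_vecMul_exp_smul b (G + lam • Matrix.diagonal κ) s j
  have hlin : HasDerivAt (fun s => y - s) (-1) s := (hasDerivAt_id s).const_sub y
  have hE1 : HasDerivAt (fun s => Real.exp (G j j * (y - s)))
      (Real.exp (G j j * (y - s)) * (G j j * (-1))) s := (hlin.const_mul (G j j)).exp
  have hE2 : HasDerivAt (fun s => Real.exp (-lam * (v - κ j * (y - s))))
      (Real.exp (-lam * (v - κ j * (y - s))) * (-lam * (-(κ j * (-1))))) s :=
    (((hlin.const_mul (κ j)).const_sub v).const_mul (-lam)).exp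
  have h := hE1.mul (hA.sub (hE2.mul hB))
  refine h.congr_deriv ?_
  rw [Matrix.vecMul_add, Matrix.vecMul_smul, Pi.add_apply, Pi.smul_apply, Matrix.vecMul_diagonal]
  have hs : ∀ w : S → ℝ, (w ᵥ* G) j = w j * G j j + ∑ i ∈ Finset.univ.erase j, G i j * w i :=
    fun w => by
      change ∑ i, w i * G i j = _
      rw [← Finset.add_sum_erase _ _ (Finset.mem_univ j)]
      simp only [mul_comm]
  rw [hs, hs]
  simp only [levelLaw, mul_sub, Finset.sum_sub_distrib, Pi.sub_apply, Pi.mul_apply, smul_eq_mul]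
  have hx : ∀ w : S → ℝ, ∑ i ∈ Finset.univ.erase j,
      G i j * (Real.exp (-lam * (v - κ j * (y - s))) * w i) =
      Real.exp (-lam * (v - κ j * (y - s))) * ∑ i ∈ Finset.univ.erase j, G i j * w i := fun w => by
    rw [Finset.mul_sum]
    exact Finset.sum_congr rfl fun i _ => by ring
  simp only [mul_sub] at hx
  rw [hx]
  ring

/-- `levelLaw` as a distribution function on the line: it vanishes at negative levels. -/
noncomputable def levelCdf (G : Matrix S S ℝ) (κ : S → ℝ) (lam : ℝ) (a b : S → ℝ) (y : ℝ) (j : S)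
    (v : ℝ) : ℝ :=
  if 0 ≤ v then levelLaw G κ lam a b y j v else 0

theorem measurable_levelCdf (G : Matrix S S ℝ) (κ : S → ℝ) (lam : ℝ) (a b : S → ℝ) (j : S) :
    Measurable fun q : ℝ × ℝ => levelCdf G κ lam a b q.1 j q.2 :=
  Measurable.ite (measurableSet_le measurable_const measurable_snd)
    (continuous_levelLaw G κ lam a b j).measurable measurable_const

theorem exists_abs_levelCdf_le (G : Matrix S S ℝ) (κ : S → ℝ) {lam : ℝ} (hlam : 0 < lam)
    (a b : S → ℝ) (Y : ℝ) :
    ∃ C, ∀ y ∈ Icc 0 Y, ∀ j v, |levelCdf G κ lam a b y j v| ≤ C := by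
  have h : ∀ (w : S → ℝ) (M : Matrix S S ℝ) (j : S), ∃ C, ∀ y ∈ Icc 0 Y,
      ‖(w ᵥ* NormedSpace.exp (y • M)) j‖ ≤ C := fun w M j =>
    isCompact_Icc.exists_bound_of_continuousOn (continuous_vecMul_exp_smul w M j).continuousOn
  choose A hA using h a G
  choose B hB using h b (G + lam • Matrix.diagonal κ)
  refine ⟨∑ j, (|A j| + |B j|), fun y hy j v => ?_⟩
  have hle : |A j| + |B j| ≤ ∑ j, (|A j| + |B j|) :=
    Finset.single_le_sum (f := fun j => |A j| + |B j|) (fun i _ => by positivity)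
      (Finset.mem_univ j)
  refine le_trans ?_ hle
  rw [levelCdf]
  split_ifs with hv
  · have h1 := (hA j y hy).trans (le_abs_self _)
    have h2 := (hB j y hy).trans (le_abs_self _)
    rw [Real.norm_eq_abs] at h1 h2
    have he : Real.exp (-lam * v) ≤ 1 := Real.exp_le_one_iff.2 (by nlinarith)
    refine (abs_sub _ _).trans (add_le_add h1 ?_)
    rw [abs_mul, abs_of_pos (Real.exp_pos _)]
    exact (mul_le_of_le_one_left (abs_nonneg _) he).trans h2
  · rw [abs_zero]
    positivity

theorem levelCdf_forward_equation {G : Matrix S S ℝ} {κ : S → ℝ} {lam : ℝ} {a b : S → ℝ}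
    (hzero : ∀ y j, 0 < κ j → levelLaw G κ lam a b y j 0 = 0)
    {y v : ℝ} (hy : 0 ≤ y) (hv : 0 ≤ v) (j : S) :
    levelCdf G κ lam a b y j v =
      Real.exp (G j j * y) * levelCdf G κ lam a b 0 j (v - κ j * y) +
      ∫ s in (0 : ℝ)..y, Real.exp (G j j * (y - s)) * ∑ i ∈ Finset.univ.erase j,
        G i j * levelCdf G κ lam a b s i (v - κ j * (y - s)) := by
  set f : ℝ → ℝ := fun s => Real.exp (G j j * (y - s)) * ∑ i ∈ Finset.univ.erase j,
        G i j * levelLaw G κ lam a b s i (v - κ j * (y - s)) with hf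
  have hfc : Continuous f := by
    have h : ∀ i, Continuous fun s => levelLaw G κ lam a b s i (v - κ j * (y - s)) := fun i =>
      (continuous_levelLaw G κ lam a b i).comp
        (by fun_prop : Continuous fun s : ℝ => (s, v - κ j * (y - s)))
    rw [hf]
    fun_prop
  have hFTC : ∀ s₀, ∫ s in s₀..y, f s = levelLaw G κ lam a b y j v -
      Real.exp (G j j * (y - s₀)) * levelLaw G κ lam a b s₀ j (v - κ j * (y - s₀)) := by
    intro s₀
    rw [intervalIntegral.integral_eq_sub_of_hasDerivAt
      (fun s _ => hasDerivAt_levelLaw_characteristic G κ lam a b j y v s)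
      (hfc.intervalIntegrable _ _)]
    simp
  have hcongr : ∀ s, 0 ≤ v - κ j * (y - s) →
      Real.exp (G j j * (y - s)) * ∑ i ∈ Finset.univ.erase j,
        G i j * levelCdf G κ lam a b s i (v - κ j * (y - s)) = f s := by
    intro s hs
    simp only [levelCdf, if_pos hs, hf]
  by_cases h0 : 0 ≤ v - κ j * y
  · have hpos : ∀ s ∈ uIcc 0 y, 0 ≤ v - κ j * (y - s) := by
      intro s hs
      rw [uIcc_of_le hy] at hs
      rcases le_or_gt 0 (κ j) with h | h
      · nlinarith [hs.1, hs.2, mul_nonneg h hs.1]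
      · nlinarith [hs.1, hs.2, mul_nonneg (neg_nonneg.2 h.le) (sub_nonneg.2 hs.2)]
    rw [intervalIntegral.integral_congr (g := f) (fun s hs => hcongr s (hpos s hs)), hFTC 0,
      levelCdf, levelCdf, if_pos hv, if_pos h0]
    simp
  · -- the characteristic through `(y, v)` leaves the half-line at `s₀`, where the atom vanishes
    have hκ : 0 < κ j := by
      by_contra hn
      nlinarith [mul_nonneg (neg_nonneg.2 (not_lt.1 hn)) hy]
    set s₀ := y - v / κ j with hs₀
    have hvs : v - κ j * (y - s₀) = 0 := by
      rw [hs₀]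
      field_simp
      ring
    have hs0 : 0 ≤ s₀ := by
      rw [hs₀, sub_nonneg, div_le_iff₀ hκ]
      linarith
    have hsy : s₀ ≤ y := by
      have := div_nonneg hv hκ.le
      linarith
    have hz : ∀ s, s < s₀ → Real.exp (G j j * (y - s)) * ∑ i ∈ Finset.univ.erase j,
        G i j * levelCdf G κ lam a b s i (v - κ j * (y - s)) = 0 := by
      intro s hs
      have : ¬ 0 ≤ v - κ j * (y - s) := by nlinarith
      simp only [levelCdf, if_neg this]
      simp
    have hI1 : ∫ s in (0 : ℝ)..s₀, Real.exp (G j j * (y - s)) * ∑ i ∈ Finset.univ.erase j,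
        G i j * levelCdf G κ lam a b s i (v - κ j * (y - s)) = 0 := by
      rw [intervalIntegral.integral_of_le hs0, ← integral_Ioc_eq_integral_Ioo.symm]
      exact setIntegral_eq_zero_of_forall_eq_zero fun s hs => hz s hs.2
    have hpos : ∀ s ∈ uIcc s₀ y, 0 ≤ v - κ j * (y - s) := by
      intro s hs
      rw [uIcc_of_le hsy] at hs
      nlinarith [hs.1]
    have hI2 : ∫ s in s₀..y, Real.exp (G j j * (y - s)) * ∑ i ∈ Finset.univ.erase j,
        G i j * levelCdf G κ lam a b s i (v - κ j * (y - s)) = ∫ s in s₀..y, f s :=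
      intervalIntegral.integral_congr fun s hs => hcongr s (hpos s hs)
    have hint1 : IntervalIntegrable (fun s => Real.exp (G j j * (y - s)) *
        ∑ i ∈ Finset.univ.erase j, G i j * levelCdf G κ lam a b s i (v - κ j * (y - s)))
        volume 0 s₀ := by
      rw [intervalIntegrable_iff_integrableOn_Ioo_of_le hs0]
      exact integrableOn_zero.congr_fun (fun s hs => (hz s hs.2).symm) measurableSet_Ioo
    have hint2 : IntervalIntegrable (fun s => Real.exp (G j j * (y - s)) *
        ∑ i ∈ Finset.univ.erase j, G i j * levelCdf G κ lam a b s i (v - κ j * (y - s)))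
        volume s₀ y := by
      rw [intervalIntegrable_iff_integrableOn_Icc_of_le hsy]
      refine (hfc.integrableOn_Icc (a := s₀) (b := y)).congr_fun (fun s hs => ?_) measurableSet_Icc
      exact (hcongr s (hpos s (by rwa [uIcc_of_le hsy]))).symm
    rw [← intervalIntegral.integral_add_adjacent_intervals hint1 hint2, hI1, hI2, hFTC, hvs,
      hzero s₀ j hκ, levelCdf, levelCdf, if_pos hv, if_neg h0]
    ring

end

/-! ### Marked Markov chains driven by independent exponential variables -/

section

variable {S : Type*} {Ω : Type*} [MeasurableSpace Ω]
  {α : Type*} [MeasurableSpace α]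

/-- `J` is a Markov chain with transition matrix `Q`, the variables `E` are independent standard
exponential and independent of `(ξ, J)`, and the law of `J` depends on `ξ` through `J 0` only. Here
`ξ` may take values in any space, so that the property is inherited by the chain restarted at a
later step, with the whole relevant past as the new `ξ`. -/
structure IsMarkedChain (Pr : Measure Ω) (Q : Matrix S S ℝ) (ξ : Ω → α) (J : ℕ → Ω → S)
    (E : ℕ → Ω → ℝ) : Prop where
  measurable_init : Measurable ξ
  measurableSet_phase : ∀ n i, MeasurableSet {ω | J n ω = i}
  measurable_mark : ∀ n, Measurable (E n)
  law : ∀ (n : ℕ) (s : ℕ → S) (A : Set α) (B : ℕ → Set ℝ), MeasurableSet A →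
    (∀ k, MeasurableSet (B k)) →
    Pr {ω | ξ ω ∈ A ∧ (∀ k ≤ n, J k ω = s k) ∧ ∀ k ≤ n, E k ω ∈ B k} =
      Pr {ω | ξ ω ∈ A ∧ J 0 ω = s 0} *
        (∏ k ∈ Finset.range n, ENNReal.ofReal (Q (s k) (s (k + 1)))) *
        ∏ k ∈ Finset.range (n + 1), expMeasure 1 (B k)

instance : IsProbabilityMeasure (expMeasure 1) := isProbabilityMeasure_expMeasure one_pos

/-- The law of the variable `ξ` on the event that the phase `J` is `j`. -/
noncomputable def phaseLaw (Pr : Measure Ω) (J : Ω → S) (ξ : Ω → α) (j : S) : Measure α :=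
  (Pr.restrict {ω | J ω = j}).map ξ

instance (Pr : Measure Ω) [IsFiniteMeasure Pr] (J : Ω → S) (ξ : Ω → α) (j : S) :
    IsFiniteMeasure (phaseLaw Pr J ξ j) := by
  unfold phaseLaw
  infer_instance

theorem phaseLaw_apply (Pr : Measure Ω) {J : Ω → S} {ξ : Ω → α} {j : S} (hξ : Measurable ξ)
    {A : Set α} (hA : MeasurableSet A) :
    phaseLaw Pr J ξ j A = Pr {ω | ξ ω ∈ A ∧ J ω = j} := by
  rw [phaseLaw, Measure.map_apply hξ hA, Measure.restrict_apply (hξ hA)]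
  rfl

namespace IsMarkedChain

variable {Pr : Measure Ω} [IsFiniteMeasure Pr] {Q : Matrix S S ℝ} {ξ : Ω → α} {J : ℕ → Ω → S}
  {E : ℕ → Ω → ℝ}

/-- Given the phases and the later marks, the initial variable and the first mark are
independent. -/
theorem map_prodMk_restrict (h : IsMarkedChain Pr Q ξ J E) (n : ℕ) (s : ℕ → S) (B : ℕ → Set ℝ)
    (hB : ∀ k, MeasurableSet (B k)) :
    (Pr.restrict {ω | (∀ k ≤ n, J k ω = s k) ∧ ∀ k < n, E (k + 1) ω ∈ B k}).map
        (fun ω => (ξ ω, E 0 ω)) =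
      ((∏ k ∈ Finset.range n, ENNReal.ofReal (Q (s k) (s (k + 1)))) *
        ∏ k ∈ Finset.range n, expMeasure 1 (B k)) •
        (phaseLaw Pr (J 0) ξ (s 0)).prod (expMeasure 1) := by
  have hm : Measurable fun ω => (ξ ω, E 0 ω) := h.measurable_init.prodMk (h.measurable_mark 0)
  set W := (∏ k ∈ Finset.range n, ENNReal.ofReal (Q (s k) (s (k + 1)))) *
        ∏ k ∈ Finset.range n, expMeasure 1 (B k)
  have hW : W ≠ ∞ := by
    refine ENNReal.mul_ne_top (ENNReal.prod_ne_top fun _ _ => ENNReal.ofReal_ne_top)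
      (ENNReal.prod_ne_top fun _ _ => measure_ne_top _ _)
  have : IsFiniteMeasure (W • phaseLaw Pr (J 0) ξ (s 0)) := Measure.smul_finite _ hW
  rw [← Measure.prod_smul_left]
  refine (Measure.prod_eq fun A C hA hC => ?_).symm
  rw [Measure.map_apply hm (hA.prod hC), Measure.restrict_apply (hm (hA.prod hC)),
    Measure.smul_apply, phaseLaw_apply Pr h.measurable_init hA, smul_eq_mul]
  have key := h.law n s A (fun k => Nat.casesOn k C B) hA
    (fun k => by cases k; exacts [hC, hB _])
  rw [Finset.prod_range_succ'] at key
  simp only at key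
  have hset : (fun ω => (ξ ω, E 0 ω)) ⁻¹' A ×ˢ C ∩
      {ω | (∀ k ≤ n, J k ω = s k) ∧ ∀ k < n, E (k + 1) ω ∈ B k} =
      {ω | ξ ω ∈ A ∧ (∀ k ≤ n, J k ω = s k) ∧
        ∀ k ≤ n, E k ω ∈ (Nat.casesOn k C B : Set ℝ)} := by
    ext ω
    simp only [mem_inter_iff, mem_preimage, mem_prod, mem_ofPred_eq]
    constructor
    · rintro ⟨⟨h1, h2⟩, h3, h4⟩
      refine ⟨h1, h3, fun k hk => ?_⟩
      cases k with
      | zero => exact h2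
      | succ k => exact h4 k hk
    · rintro ⟨h1, h3, h4⟩
      exact ⟨⟨h1, h4 0 (Nat.zero_le _)⟩, h3, fun k hk => h4 (k + 1) hk⟩
  rw [hset, key]
  simp only [W, Nat.rec_zero]
  ring

theorem map_prodMk_restrict_phase (h : IsMarkedChain Pr Q ξ J E) (j : S) :
    (Pr.restrict {ω | J 0 ω = j}).map (fun ω => (ξ ω, E 0 ω)) =
      (phaseLaw Pr (J 0) ξ j).prod (expMeasure 1) := by
  have := h.map_prodMk_restrict 0 (fun _ => j) (fun _ => univ) fun _ => MeasurableSet.univ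
  simpa using this

end IsMarkedChain

variable [Fintype S]

theorem measure_eq_sum_fibres (Pr : Measure Ω) {J : Ω → S}
    (hJ : ∀ i, MeasurableSet {ω | J ω = i}) (A : Set Ω) :
    Pr A = ∑ i, Pr ({ω | J ω = i} ∩ A) := by
  have h1 : Pr A = Pr.restrict A (⋃ i ∈ (Finset.univ : Finset S), {ω | J ω = i}) := by
    have : (⋃ i ∈ (Finset.univ : Finset S), {ω | J ω = i}) = univ := by
      ext ω
      simp
    rw [this, Measure.restrict_apply_univ]
  rw [h1, measure_biUnion_finset _ fun i _ => hJ i]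
  · exact Finset.sum_congr rfl fun i _ => Measure.restrict_apply (hJ i)
  · intro i _ k _ hik
    exact Set.disjoint_left.2 fun ω h h' => hik (Eq.trans (Eq.symm h) h')

namespace IsMarkedChain

variable {Pr : Measure Ω} {Q : Matrix S S ℝ} {ξ : Ω → α} {J : ℕ → Ω → S} {E : ℕ → Ω → ℝ}

theorem measurable_step (h : IsMarkedChain Pr Q ξ J E) {step : S → α × ℝ → α}
    (hstep : ∀ i, Measurable (step i)) : Measurable fun ω => step (J 0 ω) (ξ ω, E 0 ω) := by
  have hm : Measurable fun ω => (ξ ω, E 0 ω) := h.measurable_init.prodMk (h.measurable_mark 0)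
  intro A hA
  have : (fun ω => step (J 0 ω) (ξ ω, E 0 ω)) ⁻¹' A =
      ⋃ i, {ω | J 0 ω = i} ∩ (fun ω => (ξ ω, E 0 ω)) ⁻¹' (step i ⁻¹' A) := by
    ext ω
    simp
  rw [this]
  exact MeasurableSet.iUnion fun i => (h.measurableSet_phase 0 i).inter (hm (hstep i hA))

variable [IsFiniteMeasure Pr]

/-- Conditioning on the first phase and mark, for an event of the chain restarted after one step. -/
theorem measure_restart (h : IsMarkedChain Pr Q ξ J E) {step : S → α × ℝ → α}
    (hstep : ∀ i, Measurable (step i)) (n : ℕ) (s : ℕ → S) (A : Set α) (B : ℕ → Set ℝ)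
    (hA : MeasurableSet A) (hB : ∀ k, MeasurableSet (B k)) :
    Pr {ω | step (J 0 ω) (ξ ω, E 0 ω) ∈ A ∧ (∀ k ≤ n, J (k + 1) ω = s k) ∧
        ∀ k ≤ n, E (k + 1) ω ∈ B k} =
      (∑ i, ENNReal.ofReal (Q i (s 0)) *
          (phaseLaw Pr (J 0) ξ i).prod (expMeasure 1) (step i ⁻¹' A)) *
        (∏ k ∈ Finset.range n, ENNReal.ofReal (Q (s k) (s (k + 1)))) *
        ∏ k ∈ Finset.range (n + 1), expMeasure 1 (B k) := by
  have hm : Measurable fun ω => (ξ ω, E 0 ω) := h.measurable_init.prodMk (h.measurable_mark 0)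
  rw [measure_eq_sum_fibres Pr (h.measurableSet_phase 0), Finset.sum_mul, Finset.sum_mul]
  refine Finset.sum_congr rfl fun i _ => ?_
  have key := congrArg (fun m => m (step i ⁻¹' A))
    (h.map_prodMk_restrict (n + 1) (fun k => Nat.casesOn k i s) B hB)
  simp only [Measure.smul_apply, smul_eq_mul] at key
  rw [Measure.map_apply hm (hstep i hA), Measure.restrict_apply (hm (hstep i hA)),
    Finset.prod_range_succ' (fun k => ENNReal.ofReal _)] at key
  have hset : {ω | J 0 ω = i} ∩ {ω | step (J 0 ω) (ξ ω, E 0 ω) ∈ A ∧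
        (∀ k ≤ n, J (k + 1) ω = s k) ∧ ∀ k ≤ n, E (k + 1) ω ∈ B k} =
      (fun ω => (ξ ω, E 0 ω)) ⁻¹' (step i ⁻¹' A) ∩
        {ω | (∀ k ≤ n + 1, J k ω = (Nat.casesOn k i s : S)) ∧ ∀ k < n + 1, E (k + 1) ω ∈ B k} := by
    ext ω
    simp only [mem_inter_iff, mem_preimage, mem_ofPred_eq]
    constructor
    · rintro ⟨h1, h2, h3, h4⟩
      rw [h1] at h2
      refine ⟨h2, fun k hk => ?_, fun k hk => h4 k (Nat.lt_succ_iff.1 hk)⟩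
      cases k with
      | zero => exact h1
      | succ k => exact h3 k (Nat.succ_le_succ_iff.1 hk)
    · rintro ⟨h2, h3, h4⟩
      have h1 : J 0 ω = i := h3 0 (Nat.zero_le _)
      rw [h1]
      exact ⟨rfl, h2, fun k hk => h3 (k + 1) (Nat.succ_le_succ hk),
        fun k hk => h4 k (Nat.lt_succ_of_le hk)⟩
  rw [hset, key]
  simp only [Nat.rec_zero]
  ring

theorem phaseLaw_step (h : IsMarkedChain Pr Q ξ J E) {step : S → α × ℝ → α}
    (hstep : ∀ i, Measurable (step i)) {A : Set α} (hA : MeasurableSet A) (j : S) :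
    Pr {ω | step (J 0 ω) (ξ ω, E 0 ω) ∈ A ∧ J 1 ω = j} =
      ∑ i, ENNReal.ofReal (Q i j) *
        (phaseLaw Pr (J 0) ξ i).prod (expMeasure 1) (step i ⁻¹' A) := by
  have := h.measure_restart hstep 0 (fun _ => j) A (fun _ => univ) hA fun _ => MeasurableSet.univ
  simpa using this

/-- The Markov property at the first step. -/
theorem restart (h : IsMarkedChain Pr Q ξ J E) {step : S → α × ℝ → α}
    (hstep : ∀ i, Measurable (step i)) :
    IsMarkedChain Pr Q (fun ω => step (J 0 ω) (ξ ω, E 0 ω)) (fun k => J (k + 1))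
      fun k => E (k + 1) where
  measurable_init := h.measurable_step hstep
  measurableSet_phase n i := h.measurableSet_phase (n + 1) i
  measurable_mark n := h.measurable_mark (n + 1)
  law n s A B hA hB := by
    rw [h.measure_restart hstep n s A B hA hB, h.phaseLaw_step hstep hA]

end IsMarkedChain

/-- The state obtained from the initial value `ξ` by applying `step` with the successive phases
and marks. -/
def markedState (step : S → α × ℝ → α) (ξ : Ω → α) (J : ℕ → Ω → S) (E : ℕ → Ω → ℝ) :
    ℕ → Ω → α
  | 0 => ξ
  | n + 1 => fun ω => step (J n ω) (markedState step ξ J E n ω, E n ω)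

namespace IsMarkedChain

variable {Pr : Measure Ω} [IsFiniteMeasure Pr] {Q : Matrix S S ℝ} {ξ : Ω → α} {J : ℕ → Ω → S}
  {E : ℕ → Ω → ℝ}

theorem restart_iterate (h : IsMarkedChain Pr Q ξ J E) {step : S → α × ℝ → α}
    (hstep : ∀ i, Measurable (step i)) (n : ℕ) :
    IsMarkedChain Pr Q (markedState step ξ J E n) (fun k => J (k + n)) fun k => E (k + n) := by
  induction n with
  | zero => exact h
  | succ n ih =>
    have := ih.restart hstep
    simp only [zero_add, Nat.add_right_comm _ 1 n] at this
    exact this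

theorem measurable_markedState (h : IsMarkedChain Pr Q ξ J E) {step : S → α × ℝ → α}
    (hstep : ∀ i, Measurable (step i)) (n : ℕ) : Measurable (markedState step ξ J E n) :=
  (h.restart_iterate hstep n).measurable_init

/-- The mark of a step is independent of the state before that step. -/
theorem measure_markedState_mark (h : IsMarkedChain Pr Q ξ J E) {step : S → α × ℝ → α}
    (hstep : ∀ i, Measurable (step i)) (n : ℕ) (j : S) {C : Set (α × ℝ)} (hC : MeasurableSet C) :
    Pr {ω | (markedState step ξ J E n ω, E n ω) ∈ C ∧ J n ω = j} =
      (phaseLaw Pr (J n) (markedState step ξ J E n) j).prod (expMeasure 1) C := by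
  have h' := (h.restart_iterate hstep n).map_prodMk_restrict_phase j
  simp only [zero_add] at h'
  have hm : Measurable fun ω => (markedState step ξ J E n ω, E n ω) :=
    (h.measurable_markedState hstep n).prodMk (h.measurable_mark n)
  rw [← h', Measure.map_apply hm hC, Measure.restrict_apply (hm hC)]
  rfl

/-- The law of the state evolves by one jump of the chain and one exponential mark. -/
theorem phaseLaw_markedState_succ (h : IsMarkedChain Pr Q ξ J E) {step : S → α × ℝ → α}
    (hstep : ∀ i, Measurable (step i)) (n : ℕ) (j : S) :
    phaseLaw Pr (J (n + 1)) (markedState step ξ J E (n + 1)) j =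
      ∑ i, ENNReal.ofReal (Q i j) •
        ((phaseLaw Pr (J n) (markedState step ξ J E n) i).prod (expMeasure 1)).map (step i) := by
  ext A hA
  have h' := (h.restart_iterate hstep n).phaseLaw_step hstep hA j
  simp only [zero_add, add_comm 1 n] at h'
  rw [phaseLaw_apply Pr (h.measurable_markedState hstep (n + 1)) hA, Measure.finsetSum_apply]
  refine Eq.trans h' (Finset.sum_congr rfl fun i _ => ?_)
  rw [Measure.smul_apply, Measure.map_apply (hstep i) hA, smul_eq_mul]

theorem ae_mark_pos (h : IsMarkedChain Pr Q ξ J E) : ∀ᵐ ω ∂Pr, ∀ n, 0 < E n ω := by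
  rw [ae_all_iff]
  intro n
  rw [ae_iff, measure_eq_sum_fibres Pr (h.measurableSet_phase n)]
  refine Finset.sum_eq_zero fun j _ => ?_
  have h0 : expMeasure 1 (Iic (0 : ℝ)) = 0 := by
    have h1 := cdf_expMeasure_eq (one_pos : (0 : ℝ) < 1) 0
    rw [ProbabilityTheory.cdf_eq_real] at h1
    rw [← measureReal_eq_zero_iff]
    simpa using h1
  have h2 := h.measure_markedState_mark (step := fun _ q => q.1) (fun _ => measurable_fst) n j
    (C := univ ×ˢ Iic 0) (MeasurableSet.univ.prod measurableSet_Iic)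
  rw [Measure.prod_prod, h0, mul_zero] at h2
  rw [← h2]
  congr 1
  ext ω
  simp [and_comm]

end IsMarkedChain

end

/-! ### Paths of the fluid level -/

section

variable {S : Type*}

/-- On an interval on which the phase is constant, the level moves linearly until it is stopped
at `0`. -/
theorem level_eq_max_of_constant_phase {X : ℝ → ℝ} (hX : Continuous X) (hX0 : ∀ t, 0 ≤ X t)
    {s t d : ℝ} (hst : s ≤ t)
    (h : ∀ u ∈ Icc s t, X u = X s + ∫ w in s..u, (if 0 < X w then d else max 0 d)) :
    X t = max 0 (X s + d * (t - s)) := by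
  rcases le_or_gt 0 d with hd | hd
  · have h1 := h t ⟨hst, le_rfl⟩
    simp only [max_eq_right hd, ite_self, intervalIntegral.integral_const, smul_eq_mul] at h1
    rw [h1, max_eq_right]
    · ring
    · have := hX0 s
      have := mul_nonneg hd (sub_nonneg.2 hst)
      linarith
  · have hmeas : Measurable fun w => if 0 < X w then d else max 0 d :=
      Measurable.ite (measurableSet_lt measurable_const hX.measurable) measurable_const
        measurable_const
    have hval : ∀ w, (if 0 < X w then d else max 0 d) = d ∨
        (X w = 0 ∧ (if 0 < X w then d else max 0 d) = 0) := by
      intro w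
      split_ifs with hw
      · exact Or.inl rfl
      · exact Or.inr ⟨le_antisymm (not_lt.1 hw) (hX0 w), max_eq_left hd.le⟩
    have hint : ∀ u w, IntervalIntegrable (fun w => if 0 < X w then d else max 0 d) volume u w := by
      intro u w
      refine (intervalIntegrable_const (c := |d|)).mono_fun hmeas.aestronglyMeasurable ?_
      refine ae_of_all _ fun x => ?_
      dsimp only
      rcases hval x with hx | ⟨_, hx⟩ <;> rw [hx] <;> simp
    have hsub : ∀ u ∈ Icc s t, X t = X u + ∫ w in u..t, (if 0 < X w then d else max 0 d) := by
      intro u hu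
      rw [h t ⟨hst, le_rfl⟩, h u hu, add_assoc,
        intervalIntegral.integral_add_adjacent_intervals (hint _ _) (hint _ _)]
    have hanti : ∀ u ∈ Icc s t, X t ≤ X u := by
      intro u hu
      have : ∫ w in u..t, (if 0 < X w then d else max 0 d) ≤ 0 := by
        rw [intervalIntegral.integral_of_le hu.2]
        refine integral_nonpos fun w => ?_
        dsimp only [Pi.zero_apply]
        rcases hval w with hx | ⟨_, hx⟩ <;> rw [hx]
        exact hd.le
      rw [hsub u hu]
      linarith
    -- as the level decreases, it is positive on the whole interval unless it vanishes at `t`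
    rcases (hX0 t).eq_or_lt with h0 | hpos
    · rw [← h0, max_eq_left]
      have hge : ∫ w in s..t, d ≤ ∫ w in s..t, (if 0 < X w then d else max 0 d) := by
        refine intervalIntegral.integral_mono hst intervalIntegrable_const (hint _ _) fun w => ?_
        dsimp only
        rcases hval w with hx | ⟨_, hx⟩ <;> rw [hx]
        exact hd.le
      rw [intervalIntegral.integral_const, smul_eq_mul] at hge
      have := hsub s ⟨le_rfl, hst⟩
      linarith
    · have h1 := hsub s ⟨le_rfl, hst⟩
      have h2 : ∫ w in s..t, (if 0 < X w then d else max 0 d) = ∫ w in s..t, d := by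
        refine intervalIntegral.integral_congr fun w hw => ?_
        rw [uIcc_of_le hst] at hw
        exact if_pos (hpos.trans_le (hanti w hw))
      rw [h2, intervalIntegral.integral_const, smul_eq_mul] at h1
      rw [max_eq_right] <;> linarith

/-- The data of a path at time `t`: the in-out fluid is `τ`, the level is `z`, and the integrals
defining them up to time `t` are genuine. -/
structure PathAt (c r : S → ℝ) (φ : ℝ → S) (X : ℝ → ℝ) (t τ z : ℝ) : Prop where
  integrable_rate : IntervalIntegrable
    (fun u => if 0 < X u then c (φ u) else max 0 (c (φ u))) volume 0 t
  integrable_inOut : IntervalIntegrable (fun u => |r (φ u)|) volume 0 t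
  inOut_eq : ∫ u in (0 : ℝ)..t, |r (φ u)| = τ
  level_eq : X t = z

theorem intervalIntegrable_and_integral_congr_Ico {f g : ℝ → ℝ} {s t : ℝ} (hst : s ≤ t)
    (hg : IntervalIntegrable g volume s t) (h : ∀ u ∈ Ico s t, f u = g u) :
    IntervalIntegrable f volume s t ∧ ∫ u in s..t, f u = ∫ u in s..t, g u := by
  constructor
  · rw [intervalIntegrable_iff_integrableOn_Ico_of_le hst] at hg ⊢
    exact hg.congr_fun (fun u hu => (h u hu).symm) measurableSet_Ico
  · rw [intervalIntegral.integral_of_le hst, intervalIntegral.integral_of_le hst,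
      integral_Ioc_eq_integral_Ioo, integral_Ioc_eq_integral_Ioo]
    exact setIntegral_congr_fun measurableSet_Ioo fun u hu => h u (Ioo_subset_Ico_self hu)

theorem PathAt.advance {c r : S → ℝ} {φ : ℝ → S} {X : ℝ → ℝ} (hX : IsFluidLevel c φ X)
    {s t τ z : ℝ} {i : S} (h : PathAt c r φ X s τ z) (hs : 0 ≤ s) (hst : s ≤ t)
    (hφ : ∀ u ∈ Ico s t, φ u = i) :
    PathAt c r φ X t (τ + |r i| * (t - s)) (max 0 (z + c i * (t - s))) := by
  obtain ⟨hcont, hnonneg, hint⟩ := hX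
  -- a globally continuous and nonnegative version of the level
  set X' : ℝ → ℝ := fun u => X (max u 0) with hX'
  have hX'c : Continuous X' := hcont.comp_continuous (by fun_prop) fun u =>
    mem_Ici.2 (le_max_right _ _)
  have hX'eq : ∀ u, 0 ≤ u → X' u = X u := fun u hu => by rw [hX']; simp only [max_eq_left hu]
  have hgm : Measurable fun w => if 0 < X' w then c i else max 0 (c i) :=
    Measurable.ite (measurableSet_lt measurable_const hX'c.measurable) measurable_const
      measurable_const
  have hgint : ∀ u w, IntervalIntegrable (fun w => if 0 < X' w then c i else max 0 (c i))
      volume u w := by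
    intro u w
    refine (intervalIntegrable_const (c := |c i| + |max 0 (c i)|)).mono_fun
      hgm.aestronglyMeasurable ?_
    refine ae_of_all _ fun x => ?_
    dsimp only
    rw [Real.norm_eq_abs]
    refine le_trans ?_ (le_abs_self _)
    split_ifs
    · exact le_add_of_nonneg_right (abs_nonneg _)
    · exact le_add_of_nonneg_left (abs_nonneg _)
  have hrate : ∀ u ∈ Icc s t,
      IntervalIntegrable (fun u => if 0 < X u then c (φ u) else max 0 (c (φ u))) volume s u ∧
      ∫ w in s..u, (if 0 < X w then c (φ w) else max 0 (c (φ w))) =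
        ∫ w in s..u, (if 0 < X' w then c i else max 0 (c i)) := by
    intro u hu
    refine intervalIntegrable_and_integral_congr_Ico hu.1 (hgint s u) fun w hw => ?_
    rw [hφ w ⟨hw.1, hw.2.trans_le hu.2⟩, hX'eq w (hs.trans hw.1)]
  have hr := intervalIntegrable_and_integral_congr_Ico hst
    (intervalIntegrable_const (c := |r i|) (μ := volume)) fun u hu =>
      (by rw [hφ u hu] : |r (φ u)| = |r i|)
  refine ⟨h.integrable_rate.trans (hrate t ⟨hst, le_rfl⟩).1, h.integrable_inOut.trans hr.1, ?_, ?_⟩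
  · rw [← intervalIntegral.integral_add_adjacent_intervals h.integrable_inOut hr.1, h.inOut_eq,
      hr.2, intervalIntegral.integral_const, smul_eq_mul, mul_comm]
  · rw [← h.level_eq, ← hX'eq t (hs.trans hst), ← hX'eq s hs]
    refine level_eq_max_of_constant_phase hX'c (fun u => hnonneg _ (le_max_right _ _)) hst
      fun u hu => ?_
    rw [hX'eq u (hs.trans hu.1), hX'eq s hs, hint u (hs.trans hu.1), hint s hs,
      ← (hrate u hu).2, add_assoc, intervalIntegral.integral_add_adjacent_intervals
        h.integrable_rate (hrate u hu).1]

theorem PathAt.inOutTime_eq {c r : S → ℝ} (hr : ∀ i, r i ≠ 0) {φ : ℝ → S} {X : ℝ → ℝ}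
    {t y z : ℝ} (h : PathAt c r φ X t y z) (ht : 0 ≤ t) (hy : 0 < y) : inOutTime r φ y = t := by
  have ht' : 0 < t := by
    refine ht.lt_of_ne fun h0 => hy.ne ?_
    rw [← h.inOut_eq, ← h0, intervalIntegral.integral_same]
  refine IsLeast.csInf_eq ⟨⟨ht', h.inOut_eq⟩, ?_⟩
  rintro s ⟨hs, hsy⟩
  by_contra hlt
  push Not at hlt
  have hmem : s ∈ uIcc 0 t := by
    rw [uIcc_of_le ht]
    exact ⟨hs.le, hlt.le⟩
  have h1 : IntervalIntegrable (fun u => |r (φ u)|) volume 0 s :=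
    h.integrable_inOut.mono_set (uIcc_subset_uIcc left_mem_uIcc hmem)
  have h2 : IntervalIntegrable (fun u => |r (φ u)|) volume s t :=
    h.integrable_inOut.mono_set (uIcc_subset_uIcc hmem right_mem_uIcc)
  have hadd := intervalIntegral.integral_add_adjacent_intervals h1 h2
  have hpos : 0 < ∫ u in s..t, |r (φ u)| :=
    intervalIntegral.intervalIntegral_pos_of_pos h2 (fun u => abs_pos.2 (hr _)) hlt
  rw [hsy, h.inOut_eq] at hadd
  linarith

/-- One step of the pair (in-out fluid, level) seen at the jumps of the phase: in phase `i`, with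
exit rate `q i` and drift `κ i` per unit of in-out fluid, an exponential mark `e` makes the in-out
fluid grow by `e / q i`. -/
noncomputable def fluidStep (q κ : S → ℝ) (i : S) (x : (ℝ × ℝ) × ℝ) : ℝ × ℝ :=
  (x.1.1 + x.2 / q i, max 0 (x.1.2 + κ i * (x.2 / q i)))

theorem measurable_fluidStep (q κ : S → ℝ) (i : S) : Measurable (fluidStep q κ i) := by
  unfold fluidStep
  fun_prop

/-- The phase and the level at the in-out fluid `y`, when `y` is reached during the stay of the
phase process in the `n`-th visited phase. -/
theorem phase_level_at_inOutTime {T : Matrix S S ℝ} {c r : S → ℝ} (hr : ∀ i, r i ≠ 0)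
    (hT : ∀ i, T i i ≤ 0) {φ : ℝ → S} {X : ℝ → ℝ} {J : ℕ → S} {E : ℕ → ℝ} (hE : ∀ k, 0 < E k)
    (hφ : ∀ (n : ℕ) (t : ℝ), 0 ≤ t → jumpTime T J E n ≤ ENNReal.ofReal t →
      ENNReal.ofReal t < jumpTime T J E (n + 1) → φ t = J n)
    (hX : IsFluidLevel c φ X) {x : ℕ → ℝ × ℝ} (hx0 : x 0 = (0, X 0))
    (hx : ∀ k, x (k + 1) =
      fluidStep (fun i => -T i i / |r i|) (fun i => c i / |r i|) (J k) (x k, E k))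
    {n : ℕ} (hn : ∀ k < n, T (J k) (J k) ≠ 0) {y : ℝ} (hy : 0 < y) (h1 : (x n).1 ≤ y)
    (h2 : -T (J n) (J n) / |r (J n)| * (y - (x n).1) < E n) :
    φ (inOutTime r φ y) = J n ∧
      X (inOutTime r φ y) = max 0 ((x n).2 + c (J n) / |r (J n)| * (y - (x n).1)) := by
  have hrpos : ∀ i, 0 < |r i| := fun i => abs_pos.2 (hr i)
  have hq : ∀ k < n, 0 < -T (J k) (J k) := fun k hk =>
    neg_pos.2 ((hT _).lt_of_ne (hn k hk))
  set σ : ℕ → ℝ := fun m => ∑ k ∈ Finset.range m, E k / (-T (J k) (J k)) with hσ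
  have hσ0 : ∀ m ≤ n, 0 ≤ σ m := fun m hm => Finset.sum_nonneg fun k hk =>
    div_nonneg (hE k).le (hq k ((Finset.mem_range.1 hk).trans_le hm)).le
  have hσs : ∀ m, σ (m + 1) = σ m + E m / (-T (J m) (J m)) := fun m => Finset.sum_range_succ _ _
  have hjt : ∀ m ≤ n, jumpTime T J E m = ENNReal.ofReal (σ m) := by
    intro m hm
    rw [jumpTime, hσ, ENNReal.ofReal_sum_of_nonneg]
    · exact Finset.sum_congr rfl fun k hk =>
        (ENNReal.ofReal_div_of_pos (hq k ((Finset.mem_range.1 hk).trans_le hm))).symm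
    · exact fun k hk => div_nonneg (hE k).le (hq k ((Finset.mem_range.1 hk).trans_le hm)).le
  have key : ∀ m ≤ n, PathAt c r φ X (σ m) (x m).1 (x m).2 := by
    intro m
    induction m with
    | zero =>
      intro _
      have : σ 0 = 0 := Finset.sum_range_zero _
      rw [this, hx0]
      exact ⟨by simp, by simp, by simp, rfl⟩
    | succ m ih =>
      intro hm
      have hm' : m ≤ n := (Nat.le_succ m).trans hm
      have hpos := hq m hm
      have hle : σ m ≤ σ (m + 1) := by
        rw [hσs]
        exact le_add_of_nonneg_right (div_nonneg (hE m).le hpos.le)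
      have h := (ih hm').advance hX (hσ0 m hm') hle (i := J m) fun u hu => by
        have hu0 := (hσ0 m hm').trans hu.1
        refine hφ m u hu0 ?_ ?_
        · rw [hjt m hm']
          exact ENNReal.ofReal_le_ofReal hu.1
        · rw [hjt _ hm]
          exact (ENNReal.ofReal_lt_ofReal_iff (hu0.trans_lt hu.2)).2 hu.2
      have hr0 := (hrpos (J m)).ne'
      have hT0 := hn m hm
      have e1 : E m / (-T (J m) (J m) / |r (J m)|) = |r (J m)| * (σ (m + 1) - σ m) := by
        rw [hσs]
        field_simp
        ring
      have e2 : c (J m) / |r (J m)| * (|r (J m)| * (σ (m + 1) - σ m)) =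
          c (J m) * (σ (m + 1) - σ m) := by
        field_simp
      simp only [hx m, fluidStep]
      rw [e1, e2]
      exact h
  set t := σ n + (y - (x n).1) / |r (J n)| with ht
  have hdt : 0 ≤ (y - (x n).1) / |r (J n)| := div_nonneg (sub_nonneg.2 h1) (hrpos _).le
  have hσt : σ n ≤ t := le_add_of_nonneg_right hdt
  have hφn : ∀ u, σ n ≤ u → u ≤ t → φ u = J n := by
    intro u hu hut
    have hu0 := (hσ0 n le_rfl).trans hu
    refine hφ n u hu0 ?_ ?_
    · rw [hjt n le_rfl]
      exact ENNReal.ofReal_le_ofReal hu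
    · have hs : jumpTime T J E (n + 1) = jumpTime T J E n +
          ENNReal.ofReal (E n) / ENNReal.ofReal (-T (J n) (J n)) := Finset.sum_range_succ _ _
      rw [hs]
      rcases (neg_nonneg.2 (hT (J n))).eq_or_lt with h0 | hpos
      · rw [← h0, ENNReal.ofReal_zero, ENNReal.div_zero
          (ENNReal.ofReal_pos.2 (hE n)).ne', add_top]
        exact ENNReal.ofReal_lt_top
      · rw [hjt n le_rfl, ← ENNReal.ofReal_div_of_pos hpos,
          ← ENNReal.ofReal_add (hσ0 n le_rfl) (div_nonneg (hE n).le hpos.le)]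
        have hlt : (y - (x n).1) / |r (J n)| < E n / (-T (J n) (J n)) := by
          rw [lt_div_iff₀ hpos]
          calc _ = -T (J n) (J n) / |r (J n)| * (y - (x n).1) := by ring
            _ < E n := h2
        refine (ENNReal.ofReal_lt_ofReal_iff ?_).2 ?_
        · linarith [hσ0 n le_rfl]
        · linarith
  have hfin := (key n le_rfl).advance hX (hσ0 n le_rfl) hσt (i := J n)
    fun u hu => hφn u hu.1 hu.2.le
  have hr0 := (hrpos (J n)).ne'
  have hy' : (x n).1 + |r (J n)| * (t - σ n) = y := by
    rw [ht]
    field_simp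
    ring
  rw [hy'] at hfin
  rw [hfin.inOutTime_eq hr ((hσ0 n le_rfl).trans hσt) hy]
  refine ⟨hφn t hσt le_rfl, ?_⟩
  rw [hfin.level_eq, ht]
  congr 2
  field_simp
  ring

end

/-! ### Mass of a stay in a fixed phase -/

section

theorem expMeasure_one_Ioi {t : ℝ} (ht : 0 ≤ t) :
    expMeasure 1 (Ioi t) = ENNReal.ofReal (Real.exp (-t)) := by
  have h1 := cdf_expMeasure_eq (one_pos : (0 : ℝ) < 1) t
  rw [ProbabilityTheory.cdf_eq_real, if_pos ht, one_mul] at h1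
  have h2 := probReal_compl_eq_one_sub (μ := expMeasure 1) (measurableSet_Iic (a := t))
  rw [compl_Iic, h1] at h2
  rw [← ofReal_measureReal, h2]
  congr 1
  ring

/-- The probability that a phase with exit rate `q` and drift `κ`, entered at in-out fluid `x.1` and
level `x.2`, still lasts at in-out fluid `y`, restricted to a level at most `v` there. -/
noncomputable def stayKernel (q κ y v : ℝ) (x : ℝ × ℝ) : ℝ≥0∞ :=
  if x.1 ≤ y ∧ max 0 (x.2 + κ * (y - x.1)) ≤ v then ENNReal.ofReal (Real.exp (-(q * (y - x.1))))
  else 0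

/-- `stayKernel` integrated against the law `m` of the in-out fluid and the level at the entrance
of the phase. -/
noncomputable def stayMass (m : Measure (ℝ × ℝ)) (q κ y v : ℝ) : ℝ≥0∞ :=
  ∫⁻ x, stayKernel q κ y v x ∂m

theorem measurable_stayKernel (q κ : ℝ) :
    Measurable fun z : (ℝ × ℝ) × (ℝ × ℝ) => stayKernel q κ z.1.1 z.1.2 z.2 := by
  have h1 : MeasurableSet {z : (ℝ × ℝ) × (ℝ × ℝ) | z.2.1 ≤ z.1.1} :=
    measurableSet_le (by fun_prop) (by fun_prop)
  have h2 : MeasurableSet {z : (ℝ × ℝ) × (ℝ × ℝ) |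
      max 0 (z.2.2 + κ * (z.1.1 - z.2.1)) ≤ z.1.2} :=
    measurableSet_le (by fun_prop) (by fun_prop)
  exact Measurable.ite (h1.inter h2) (by fun_prop) measurable_const

theorem measurable_stayKernel_right (q κ y v : ℝ) : Measurable (stayKernel q κ y v) :=
  (measurable_stayKernel q κ).comp (by fun_prop : Measurable fun x : ℝ × ℝ => ((y, v), x))

theorem measurableSet_stay (q κ y v : ℝ) : MeasurableSet {z : (ℝ × ℝ) × ℝ |
    (z.1.1 ≤ y ∧ max 0 (z.1.2 + κ * (y - z.1.1)) ≤ v) ∧ q * (y - z.1.1) < z.2} := by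
  have h1 : MeasurableSet {z : (ℝ × ℝ) × ℝ | z.1.1 ≤ y} :=
    measurableSet_le (by fun_prop) (by fun_prop)
  have h2 : MeasurableSet {z : (ℝ × ℝ) × ℝ | max 0 (z.1.2 + κ * (y - z.1.1)) ≤ v} :=
    measurableSet_le (by fun_prop) (by fun_prop)
  have h3 : MeasurableSet {z : (ℝ × ℝ) × ℝ | q * (y - z.1.1) < z.2} :=
    measurableSet_lt (by fun_prop) (by fun_prop)
  exact (h1.inter h2).inter h3

theorem stayKernel_le_one {q : ℝ} (hq : 0 ≤ q) (κ y v : ℝ) (x : ℝ × ℝ) :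
    stayKernel q κ y v x ≤ 1 := by
  unfold stayKernel
  split_ifs with h
  · rw [← ENNReal.ofReal_one]
    refine ENNReal.ofReal_le_ofReal (Real.exp_le_one_iff.2 ?_)
    have := mul_nonneg hq (sub_nonneg.2 h.1)
    linarith
  · exact zero_le_one

theorem stayMass_le {m : Measure (ℝ × ℝ)} {q : ℝ} (hq : 0 ≤ q) (κ y v : ℝ) :
    stayMass m q κ y v ≤ m univ :=
  (lintegral_mono fun x => stayKernel_le_one hq κ y v x).trans_eq lintegral_one

theorem stayMass_ne_top {m : Measure (ℝ × ℝ)} [IsFiniteMeasure m] {q : ℝ} (hq : 0 ≤ q)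
    (κ y v : ℝ) : stayMass m q κ y v ≠ ∞ :=
  ((stayMass_le hq κ y v).trans_lt (measure_lt_top m univ)).ne

theorem stayMass_of_neg (m : Measure (ℝ × ℝ)) (q κ y : ℝ) {v : ℝ} (hv : v < 0) :
    stayMass m q κ y v = 0 := by
  have h : ∀ x, stayKernel q κ y v x = 0 := fun x =>
    if_neg fun h => absurd ((le_max_left _ _).trans h.2) (not_le.2 hv)
  simp [stayMass, h]

theorem stayMass_of_lt {m : Measure (ℝ × ℝ)} (hm : ∀ᵐ x ∂m, 0 ≤ x.1) (q κ v : ℝ) {y : ℝ}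
    (hy : y < 0) : stayMass m q κ y v = 0 := by
  refine (lintegral_congr_ae (g := fun _ => 0) ?_).trans lintegral_zero
  filter_upwards [hm] with x hx
  exact if_neg fun h => by linarith [h.1]

theorem measurable_stayMass (m : Measure (ℝ × ℝ)) [SFinite m] (q κ : ℝ) :
    Measurable fun z : ℝ × ℝ => stayMass m q κ z.1 z.2 :=
  (measurable_stayKernel q κ).lintegral_prod_right'

theorem prod_expMeasure_stay (m : Measure (ℝ × ℝ)) {q : ℝ} (hq : 0 ≤ q) (κ y v : ℝ) :
    (m.prod (expMeasure 1)) {z | (z.1.1 ≤ y ∧ max 0 (z.1.2 + κ * (y - z.1.1)) ≤ v) ∧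
        q * (y - z.1.1) < z.2} = stayMass m q κ y v := by
  rw [Measure.prod_apply (measurableSet_stay q κ y v), stayMass]
  refine lintegral_congr fun x => ?_
  unfold stayKernel
  split_ifs with h
  · rw [← expMeasure_one_Ioi (mul_nonneg hq (sub_nonneg.2 h.1))]
    congr 1
    ext e
    exact and_iff_right h
  · rw [← measure_empty (μ := expMeasure 1)]
    congr 1
    ext e
    simp only [mem_preimage, mem_ofPred_eq, mem_empty_iff_false, iff_false]
    exact fun h' => h h'.1

theorem lintegral_comp_mul_sub {q : ℝ} (hq : 0 < q) (t : ℝ) {f : ℝ → ℝ≥0∞} (hf : Measurable f) :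
    ∫⁻ e, f e = ENNReal.ofReal q * ∫⁻ s, f (q * (s - t)) := by
  have h1 : ∫⁻ s, f (q * (s - t)) = ∫⁻ s, f (q * s) :=
    lintegral_sub_right_eq_self (fun s => f (q * s)) t
  have h2 : ∫⁻ s, f (q * s) = ENNReal.ofReal q⁻¹ * ∫⁻ e, f e := by
    rw [← lintegral_map hf (measurable_const_mul q), Real.map_volume_mul_left hq.ne',
      lintegral_smul_measure, abs_of_pos (inv_pos.2 hq), smul_eq_mul]
  rw [h1, h2, ← mul_assoc, ← ENNReal.ofReal_mul hq.le, mul_inv_cancel₀ hq.ne', ENNReal.ofReal_one,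
    one_mul]

theorem lintegral_expMeasure_one {f : ℝ → ℝ≥0∞} (hf : Measurable f) :
    ∫⁻ e, f e ∂(expMeasure 1) = ∫⁻ e, exponentialPDF 1 e * f e := by
  have hm : Measurable (exponentialPDF 1) :=
    (measurable_exponentialPDFReal 1).ennreal_ofReal
  exact lintegral_withDensity_eq_lintegral_mul _ hm hf

/-- Decomposition of a stay at the in-out fluid `s` at which the phase is entered: the entrance
density is the exit rate of the previous phase times the mass of the stay in that phase. -/
theorem stayMass_map_fluidStep {S : Type*} (m : Measure (ℝ × ℝ)) [SFinite m] {q κ : S → ℝ} {i j : S}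
    (hi : 0 < q i) (y : ℝ) {v : ℝ} (hv : 0 ≤ v) :
    stayMass ((m.prod (expMeasure 1)).map (fluidStep q κ i)) (q j) (κ j) y v =
      ENNReal.ofReal (q i) * ∫⁻ s in Iic y, ENNReal.ofReal (Real.exp (-(q j * (y - s)))) *
        stayMass m (q i) (κ i) s (v - κ j * (y - s)) := by
  have hK := measurable_stayKernel_right (q j) (κ j) y v
  have hKs : Measurable fun z => stayKernel (q j) (κ j) y v (fluidStep q κ i z) :=
    hK.comp (measurable_fluidStep q κ i)
  set H : ℝ → ℝ × ℝ → ℝ≥0∞ := fun s x => (Iic y).indicator (fun s =>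
    ENNReal.ofReal (Real.exp (-(q j * (y - s)))) *
      stayKernel (q i) (κ i) s (v - κ j * (y - s)) x) s with hH
  have hHm : Measurable fun z : (ℝ × ℝ) × ℝ => H z.2 z.1 := by
    have h0 : Measurable fun z : (ℝ × ℝ) × ℝ => ENNReal.ofReal (Real.exp (-(q j * (y - z.2)))) *
        stayKernel (q i) (κ i) z.2 (v - κ j * (y - z.2)) z.1 := by
      refine Measurable.mul (by fun_prop) ?_
      exact (measurable_stayKernel (q i) (κ i)).comp (by fun_prop :
        Measurable fun z : (ℝ × ℝ) × ℝ => ((z.2, v - κ j * (y - z.2)), z.1))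
    exact h0.indicator (measurable_snd measurableSet_Iic)
  rw [stayMass, lintegral_map hK (measurable_fluidStep q κ i), lintegral_prod _ hKs.aemeasurable]
  have hinner : ∀ x : ℝ × ℝ, ∫⁻ e, stayKernel (q j) (κ j) y v (fluidStep q κ i (x, e))
      ∂(expMeasure 1) = ENNReal.ofReal (q i) * ∫⁻ s, H s x := by
    intro x
    have hKx : Measurable fun e => stayKernel (q j) (κ j) y v (fluidStep q κ i (x, e)) :=
      hKs.comp (measurable_const.prodMk measurable_id)
    have hm : Measurable (exponentialPDF 1) := (measurable_exponentialPDFReal 1).ennreal_ofReal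
    have hp : Measurable fun e => exponentialPDF 1 e *
        stayKernel (q j) (κ j) y v (fluidStep q κ i (x, e)) := hm.mul hKx
    rw [lintegral_expMeasure_one hKx, lintegral_comp_mul_sub hi x.1 hp]
    congr 1
    refine lintegral_congr fun s => ?_
    have hdiv : q i * (s - x.1) / q i = s - x.1 := mul_div_cancel_left₀ _ hi.ne'
    simp only [fluidStep, hdiv, hH, indicator, mem_Iic, stayKernel, add_sub_cancel]
    rcases lt_or_ge s x.1 with hs | hs
    · have : q i * (s - x.1) < 0 := by nlinarith
      rw [exponentialPDF_of_neg this, zero_mul]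
      simp [not_le.2 hs]
    · have h0 : 0 ≤ q i * (s - x.1) := mul_nonneg hi.le (sub_nonneg.2 hs)
      rw [exponentialPDF_of_nonneg h0]
      have hiff : (max 0 (max 0 (x.2 + κ i * (s - x.1)) + κ j * (y - s)) ≤ v) ↔
          (max 0 (x.2 + κ i * (s - x.1)) ≤ v - κ j * (y - s)) := by
        rw [max_le_iff, le_sub_iff_add_le]
        exact ⟨fun h => h.2, fun h => ⟨hv, h⟩⟩
      simp only [hiff]
      by_cases h1 : s ≤ y <;>
        by_cases h2 : max 0 (x.2 + κ i * (s - x.1)) ≤ v - κ j * (y - s) <;>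
        simp [h1, h2, hs, mul_comm]
  rw [lintegral_congr hinner, lintegral_const_mul _ hHm.lintegral_prod_right',
    lintegral_lintegral_swap hHm.aemeasurable, ← lintegral_indicator measurableSet_Iic]
  congr 1
  refine lintegral_congr fun s => ?_
  simp only [hH, indicator]
  split_ifs
  · rw [lintegral_const_mul _ (measurable_stayKernel_right _ _ _ _), stayMass]
  · exact lintegral_zero

end

/-! ### Solving the forward integral equation by iteration -/

section

variable {S : Type*}

/-- Jointly measurable, and bounded for `y` in bounded intervals. -/
structure IsForwardSource (W : ℝ → S → ℝ → ℝ) : Prop where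
  measurable : ∀ i, Measurable fun z : ℝ × ℝ => W z.1 i z.2
  bounded : ∀ Y, ∃ C, ∀ y ∈ Icc 0 Y, ∀ i v, |W y i v| ≤ C

namespace IsForwardSource

theorem sub {W W' : ℝ → S → ℝ → ℝ} (h : IsForwardSource W) (h' : IsForwardSource W') :
    IsForwardSource fun y i v => W y i v - W' y i v where
  measurable i := (h.measurable i).sub (h'.measurable i)
  bounded Y := by
    obtain ⟨C, hC⟩ := h.bounded Y
    obtain ⟨C', hC'⟩ := h'.bounded Y
    exact ⟨C + C', fun y hy i v => (abs_sub _ _).trans (add_le_add (hC y hy i v) (hC' y hy i v))⟩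

theorem intervalIntegrable {W : ℝ → S → ℝ → ℝ} (h : IsForwardSource W) {y : ℝ} (hy : 0 ≤ y)
    (i : S) (v k : ℝ) : IntervalIntegrable (fun s => W s i (v - k * (y - s))) volume 0 y := by
  obtain ⟨C, hC⟩ := h.bounded y
  have hm : Measurable fun s => W s i (v - k * (y - s)) :=
    (h.measurable i).comp (by fun_prop : Measurable fun s : ℝ => (s, v - k * (y - s)))
  refine (intervalIntegrable_const (c := C)).mono_fun' hm.aestronglyMeasurable ?_
  filter_upwards [ae_restrict_mem measurableSet_uIoc] with s hs
  rw [uIoc_of_le hy] at hs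
  exact hC s ⟨hs.1.le, hs.2⟩ i _

end IsForwardSource

variable [Fintype S] [DecidableEq S]

/-- The integral operator of the forward equation: the last jump leads into the phase `j` at
in-out fluid `s`, and the phase then stays in `j` until `y`. -/
noncomputable def forwardOp (G : Matrix S S ℝ) (κ : S → ℝ) (W : ℝ → S → ℝ → ℝ) (y : ℝ) (j : S)
    (v : ℝ) : ℝ :=
  ∫ s in (0 : ℝ)..y, Real.exp (G j j * (y - s)) * ∑ i ∈ Finset.univ.erase j,
    G i j * W s i (v - κ j * (y - s))

namespace IsForwardSource

theorem intervalIntegrable_forwardOp {W : ℝ → S → ℝ → ℝ} (h : IsForwardSource W)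
    (G : Matrix S S ℝ) (κ : S → ℝ) {y : ℝ} (hy : 0 ≤ y) (j : S) (v : ℝ) :
    IntervalIntegrable (fun s => Real.exp (G j j * (y - s)) * ∑ i ∈ Finset.univ.erase j,
      G i j * W s i (v - κ j * (y - s))) volume 0 y := by
  have h1 : IntervalIntegrable (fun s => ∑ i ∈ Finset.univ.erase j,
      G i j * W s i (v - κ j * (y - s))) volume 0 y := by
    have := IntervalIntegrable.sum (Finset.univ.erase j) (μ := volume) (a := 0) (b := y)
      (f := fun i s => G i j * W s i (v - κ j * (y - s)))
      fun i _ => (h.intervalIntegrable hy i v (κ j)).const_mul _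
    simpa only [Finset.sum_fn] using this
  exact h1.continuousOn_mul (by fun_prop)

theorem forwardOp_sub {W W' : ℝ → S → ℝ → ℝ} (h : IsForwardSource W) (h' : IsForwardSource W')
    (G : Matrix S S ℝ) (κ : S → ℝ) {y : ℝ} (hy : 0 ≤ y) (j : S) (v : ℝ) :
    forwardOp G κ (fun y i v => W y i v - W' y i v) y j v =
      forwardOp G κ W y j v - forwardOp G κ W' y j v := by
  rw [forwardOp, forwardOp, forwardOp, ← intervalIntegral.integral_sub
    (h.intervalIntegrable_forwardOp G κ hy j v) (h'.intervalIntegrable_forwardOp G κ hy j v)]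
  refine intervalIntegral.integral_congr fun s _ => ?_
  simp only [mul_sub, Finset.sum_sub_distrib]

end IsForwardSource

theorem abs_forwardOp_le {G : Matrix S S ℝ} (hG : ∀ i j, i ≠ j → 0 ≤ G i j)
    (hd : ∀ j, G j j ≤ 0) {Γ : ℝ} (hΓ : ∀ j, ∑ i ∈ Finset.univ.erase j, G i j ≤ Γ) (κ : S → ℝ)
    {W : ℝ → S → ℝ → ℝ} {C y : ℝ} (hC : 0 ≤ C) (hΓ0 : 0 ≤ Γ) (hy : 0 ≤ y) {N : ℕ}
    (hW : ∀ s ∈ Icc 0 y, ∀ i v, |W s i v| ≤ C * ((Γ * s) ^ N / N.factorial)) (j : S) (v : ℝ) :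
    |forwardOp G κ W y j v| ≤ C * ((Γ * y) ^ (N + 1) / (N + 1).factorial) := by
  have hint : ∫ s in (0 : ℝ)..y, Γ * (C * ((Γ * s) ^ N / N.factorial)) =
      C * ((Γ * y) ^ (N + 1) / (N + 1).factorial) := by
    have h1 : ∀ s : ℝ, Γ * (C * ((Γ * s) ^ N / N.factorial)) =
        Γ ^ (N + 1) * C / N.factorial * s ^ N := fun s => by
      rw [mul_pow]
      ring
    simp only [h1]
    rw [intervalIntegral.integral_const_mul, integral_pow, Nat.factorial_succ]
    push_cast
    have : (N.factorial : ℝ) ≠ 0 := Nat.cast_ne_zero.2 (Nat.factorial_ne_zero N)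
    have : (N : ℝ) + 1 ≠ 0 := by positivity
    rw [zero_pow (Nat.succ_ne_zero N)]
    field_simp
    ring
  rw [← hint, ← Real.norm_eq_abs, forwardOp]
  refine intervalIntegral.norm_integral_le_of_norm_le hy (ae_of_all _ fun s hs => ?_)
    (Continuous.intervalIntegrable (by fun_prop) _ _)
  have hB : 0 ≤ C * ((Γ * s) ^ N / N.factorial) :=
    mul_nonneg hC (div_nonneg (pow_nonneg (mul_nonneg hΓ0 hs.1.le) _) (Nat.cast_nonneg _))
  have h1 : |∑ i ∈ Finset.univ.erase j, G i j * W s i (v - κ j * (y - s))| ≤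
      Γ * (C * ((Γ * s) ^ N / N.factorial)) := by
    refine (Finset.abs_sum_le_sum_abs _ _).trans ?_
    refine le_trans (Finset.sum_le_sum fun i hi => ?_)
      ((Finset.sum_mul _ _ _).symm.trans_le (mul_le_mul_of_nonneg_right (hΓ j) hB))
    have hGij := hG i j (Finset.ne_of_mem_erase hi)
    rw [abs_mul, abs_of_nonneg hGij]
    exact mul_le_mul_of_nonneg_left (hW s ⟨hs.1.le, hs.2⟩ i _) hGij
  rw [norm_mul, Real.norm_eq_abs, Real.norm_eq_abs, abs_of_pos (Real.exp_pos _)]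
  refine (mul_le_of_le_one_left (abs_nonneg _) (Real.exp_le_one_iff.2 ?_)).trans h1
  exact mul_nonpos_of_nonpos_of_nonneg (hd j) (sub_nonneg.2 hs.2)

/-- A bounded solution `F` of the forward equation with initial term `g 0` is the sum of the
iterates `g n` of the forward operator: the remainder after `N` terms is `O((Γ y)^N / N!)`. -/
theorem hasSum_forward_iterates {G : Matrix S S ℝ} (hG : ∀ i j, i ≠ j → 0 ≤ G i j)
    (hd : ∀ j, G j j ≤ 0) (κ : S → ℝ) {F : ℝ → S → ℝ → ℝ} {g : ℕ → ℝ → S → ℝ → ℝ}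
    (hF : IsForwardSource F) (hg : ∀ n, IsForwardSource (g n)) (hg0 : ∀ n y j v, 0 ≤ g n y j v)
    (hFneg : ∀ y j v, v < 0 → F y j v = 0) (hgneg : ∀ n y j v, v < 0 → g n y j v = 0)
    (hFeq : ∀ y j v, 0 ≤ y → 0 ≤ v → F y j v = g 0 y j v + forwardOp G κ F y j v)
    (hgeq : ∀ n y j v, 0 ≤ y → 0 ≤ v → g (n + 1) y j v = forwardOp G κ (g n) y j v)
    {y : ℝ} (hy : 0 ≤ y) (j : S) (v : ℝ) : HasSum (fun n => g n y j v) (F y j v) := by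
  -- the remainder after `N` terms is the `N`-th iterate of the forward operator on `F`
  set R : ℕ → ℝ → S → ℝ → ℝ := fun N y j v => F y j v - ∑ n ∈ Finset.range N, g n y j v with hR
  have hR0 : R 0 = F := by
    funext y j v
    simp [hR]
  have hRs : ∀ N, R (N + 1) = fun y j v => R N y j v - g N y j v := fun N => by
    funext y j v
    simp only [hR, Finset.sum_range_succ]
    ring
  have hRsrc : ∀ N, IsForwardSource (R N) := by
    intro N
    induction N with
    | zero => rwa [hR0]
    | succ N ih =>
      rw [hRs]
      exact ih.sub (hg N)
  have hRneg : ∀ N y j v, v < 0 → R N y j v = 0 := fun N y j v hv => by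
    simp [hR, hFneg y j v hv, hgneg _ y j v hv]
  have hReq : ∀ N y j v, 0 ≤ y → 0 ≤ v → R (N + 1) y j v = forwardOp G κ (R N) y j v := by
    intro N
    induction N with
    | zero =>
      intro y j v hy hv
      rw [hRs, hR0]
      simp only
      rw [hFeq y j v hy hv]
      ring
    | succ N ih =>
      intro y j v hy hv
      rw [hRs (N + 1)]
      simp only
      rw [ih y j v hy hv, hgeq N y j v hy hv, hRs N, (hRsrc N).forwardOp_sub (hg N) G κ hy j v]
  obtain ⟨C, hC⟩ := hF.bounded y
  have hC0 : 0 ≤ C := (abs_nonneg _).trans (hC y ⟨hy, le_rfl⟩ j v)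
  set Γ := ∑ j, ∑ i ∈ Finset.univ.erase j, G i j with hΓdef
  have hcol : ∀ j, 0 ≤ ∑ i ∈ Finset.univ.erase j, G i j := fun j =>
    Finset.sum_nonneg fun i hi => hG i j (Finset.ne_of_mem_erase hi)
  have hΓ : ∀ j, ∑ i ∈ Finset.univ.erase j, G i j ≤ Γ := fun j =>
    Finset.single_le_sum (f := fun j => ∑ i ∈ Finset.univ.erase j, G i j) (fun j _ => hcol j)
      (Finset.mem_univ j)
  have hΓ0 : 0 ≤ Γ := Finset.sum_nonneg fun j _ => hcol j
  have hbound : ∀ N, ∀ s ∈ Icc 0 y, ∀ i w, |R N s i w| ≤ C * ((Γ * s) ^ N / N.factorial) := by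
    intro N
    induction N with
    | zero =>
      intro s hs i w
      rw [hR0]
      simpa using hC s hs i w
    | succ N ih =>
      intro s hs i w
      rcases lt_or_ge w 0 with hw | hw
      · rw [hRneg _ _ _ _ hw, abs_zero]
        exact mul_nonneg hC0 (div_nonneg (pow_nonneg (mul_nonneg hΓ0 hs.1) _) (Nat.cast_nonneg _))
      · rw [hReq N s i w hs.1 hw]
        exact abs_forwardOp_le hG hd hΓ κ hC0 hΓ0 hs.1
          (fun u hu => ih u ⟨hu.1, hu.2.trans hs.2⟩) i w
  rw [hasSum_iff_tendsto_nat_of_nonneg fun n => hg0 n y j v]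
  have hlim : Tendsto (fun N => R N y j v) atTop (𝓝 0) := by
    refine squeeze_zero_norm (fun N => hbound N y ⟨hy, le_rfl⟩ j v) ?_
    simpa using (FloorSemiring.tendsto_pow_div_factorial_atTop (Γ * y)).const_mul C
  have := hlim.const_sub (F y j v)
  simpa [hR] using this

end

/-! ### The forward equation for the marked chain -/

section

variable {S : Type*} [Fintype S] {Ω : Type*} [MeasurableSpace Ω]

/-- The law of (in-out fluid, level) at the entrance of the `n`-th visited phase, on the event that
this phase is `j`. -/
noncomputable def entranceLaw (Pr : Measure Ω) (q κ : S → ℝ) (ξ : Ω → ℝ × ℝ) (J : ℕ → Ω → S)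
    (E : ℕ → Ω → ℝ) (n : ℕ) (j : S) : Measure (ℝ × ℝ) :=
  phaseLaw Pr (J n) (markedState (fluidStep q κ) ξ J E n) j

instance (Pr : Measure Ω) [IsFiniteMeasure Pr] (q κ : S → ℝ) (ξ : Ω → ℝ × ℝ) (J : ℕ → Ω → S)
    (E : ℕ → Ω → ℝ) (n : ℕ) (j : S) : IsFiniteMeasure (entranceLaw Pr q κ ξ J E n j) := by
  unfold entranceLaw
  infer_instance

/-- The probability that at in-out fluid `y` the phase process is in its `n`-th visited phase, this
phase is `j`, and the level is at most `v`. -/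
noncomputable def stayProb (Pr : Measure Ω) (q κ : S → ℝ) (ξ : Ω → ℝ × ℝ) (J : ℕ → Ω → S)
    (E : ℕ → Ω → ℝ) (n : ℕ) (y : ℝ) (j : S) (v : ℝ) : ℝ :=
  (stayMass (entranceLaw Pr q κ ξ J E n j) (q j) (κ j) y v).toReal

theorem isForwardSource_stayProb (Pr : Measure Ω) [IsFiniteMeasure Pr] {q : S → ℝ}
    (hq : ∀ i, 0 ≤ q i) (κ : S → ℝ) (ξ : Ω → ℝ × ℝ) (J : ℕ → Ω → S) (E : ℕ → Ω → ℝ) (n : ℕ) :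
    IsForwardSource (stayProb Pr q κ ξ J E n) where
  measurable i := (measurable_stayMass _ _ _).ennreal_toReal
  bounded Y := by
    refine ⟨∑ j, (entranceLaw Pr q κ ξ J E n j univ).toReal, fun y _ i v => ?_⟩
    rw [stayProb, abs_of_nonneg ENNReal.toReal_nonneg]
    refine (ENNReal.toReal_mono (measure_ne_top _ _) (stayMass_le (hq i) _ _ _)).trans ?_
    exact Finset.single_le_sum (f := fun j => (entranceLaw Pr q κ ξ J E n j univ).toReal)
      (fun _ _ => ENNReal.toReal_nonneg) (Finset.mem_univ i)

theorem stayProb_succ [DecidableEq S] {Pr : Measure Ω} [IsFiniteMeasure Pr] {Q G : Matrix S S ℝ}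
    {κ : S → ℝ} {ξ : Ω → ℝ × ℝ} {J : ℕ → Ω → S} {E : ℕ → Ω → ℝ} (h : IsMarkedChain Pr Q ξ J E)
    (hQ0 : ∀ i j, 0 ≤ Q i j) (hQd : ∀ i, Q i i = 0) (hG : ∀ i, G i i < 0)
    (hQ : ∀ i j, i ≠ j → Q i j * -G i i = G i j) {n : ℕ}
    (htime : ∀ᵐ ω ∂Pr, 0 ≤ (markedState (fluidStep (fun i => -G i i) κ) ξ J E n ω).1)
    {y v : ℝ} (hy : 0 ≤ y) (hv : 0 ≤ v) (j : S) :
    stayProb Pr (fun i => -G i i) κ ξ J E (n + 1) y j v =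
      forwardOp G κ (stayProb Pr (fun i => -G i i) κ ξ J E n) y j v := by
  set q : S → ℝ := fun i => -G i i with hqdef
  have hq : ∀ i, 0 < q i := fun i => neg_pos.2 (hG i)
  set m : S → Measure (ℝ × ℝ) := entranceLaw Pr q κ ξ J E n with hm
  have hstep := measurable_fluidStep q κ
  have hsrc := isForwardSource_stayProb Pr (fun i => (hq i).le) κ ξ J E n
  have hmtime : ∀ i, ∀ᵐ x ∂(m i), 0 ≤ x.1 := fun i => by
    rw [hm, entranceLaw, phaseLaw, ae_map_iff (h.measurable_markedState hstep n).aemeasurable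
      (measurableSet_le measurable_const measurable_fst)]
    exact ae_restrict_of_ae htime
  set f : S → ℝ → ℝ≥0∞ := fun i s => ENNReal.ofReal (Real.exp (-(q j * (y - s)))) *
    stayMass (m i) (q i) (κ i) s (v - κ j * (y - s)) with hf
  have hfm : ∀ i, Measurable (f i) := fun i =>
    Measurable.mul (by fun_prop) ((measurable_stayMass (m i) (q i) (κ i)).comp
      (by fun_prop : Measurable fun s : ℝ => (s, v - κ j * (y - s))))
  have hftop : ∀ i s, f i s < ∞ := fun i s =>
    ENNReal.mul_lt_top ENNReal.ofReal_lt_top (stayMass_ne_top (hq i).le _ _ _).lt_top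
  have hfreal : ∀ i s, (f i s).toReal =
      Real.exp (G j j * (y - s)) * stayProb Pr q κ ξ J E n s i (v - κ j * (y - s)) := by
    intro i s
    rw [hf, ENNReal.toReal_mul, ENNReal.toReal_ofReal (Real.exp_pos _).le, stayProb, hqdef]
    simp only [neg_mul, neg_neg]
    rfl
  have hIic : ∀ i, ∫⁻ s in Iic y, f i s = ∫⁻ s in Ioc 0 y, f i s := by
    intro i
    have h0 : ∫⁻ s in Iic 0, f i s = 0 := by
      rw [← setLIntegral_congr (Iio_ae_eq_Iic (μ := volume) (a := (0 : ℝ)))]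
      refine (setLIntegral_congr_fun (g := fun _ => 0) measurableSet_Iio fun s hs => ?_).trans
        lintegral_zero
      rw [hf]
      simp only
      rw [stayMass_of_lt (hmtime i) _ _ _ hs, mul_zero]
    rw [← Iic_union_Ioc_eq_Iic hy, lintegral_union measurableSet_Ioc (Iic_disjoint_Ioc le_rfl), h0,
      zero_add]
  have hsum : stayMass (entranceLaw Pr q κ ξ J E (n + 1) j) (q j) (κ j) y v =
      ∑ i, ENNReal.ofReal (Q i j) * (ENNReal.ofReal (q i) * ∫⁻ s in Ioc 0 y, f i s) := by
    rw [entranceLaw, h.phaseLaw_markedState_succ hstep, stayMass, lintegral_finsetSum_measure]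
    refine Finset.sum_congr rfl fun i _ => ?_
    rw [lintegral_smul_measure, smul_eq_mul, ← hIic]
    exact congrArg _ (stayMass_map_fluidStep (m i) (hq i) y hv)
  have hItop : ∀ i, ∫⁻ s in Ioc 0 y, f i s ≠ ∞ := by
    intro i
    have h1 : ∀ s ∈ Ioc 0 y, f i s ≤ 1 * m i univ := fun s hs => by
      refine mul_le_mul' ?_ (stayMass_le (hq i).le _ _ _)
      rw [← ENNReal.ofReal_one]
      refine ENNReal.ofReal_le_ofReal (Real.exp_le_one_iff.2 ?_)
      have := mul_nonneg (hq j).le (sub_nonneg.2 hs.2)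
      linarith
    refine ((setLIntegral_mono measurable_const h1).trans_lt ?_).ne
    rw [setLIntegral_const, Real.volume_Ioc]
    exact ENNReal.mul_lt_top (ENNReal.mul_lt_top ENNReal.one_lt_top (measure_lt_top _ _))
      ENNReal.ofReal_lt_top
  rw [stayProb, hsum, ENNReal.toReal_sum fun i _ =>
    ENNReal.mul_ne_top ENNReal.ofReal_ne_top (ENNReal.mul_ne_top ENNReal.ofReal_ne_top (hItop i)),
    forwardOp]
  have hterm : ∀ i, (ENNReal.ofReal (Q i j) * (ENNReal.ofReal (q i) *
      ∫⁻ s in Ioc 0 y, f i s)).toReal = Q i j * q i * ∫ s in (0 : ℝ)..y,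
        Real.exp (G j j * (y - s)) * stayProb Pr q κ ξ J E n s i (v - κ j * (y - s)) := by
    intro i
    rw [ENNReal.toReal_mul, ENNReal.toReal_mul, ENNReal.toReal_ofReal (hQ0 i j),
      ENNReal.toReal_ofReal (hq i).le, ← integral_toReal (hfm i).aemeasurable
        (ae_of_all _ (hftop i)), intervalIntegral.integral_of_le hy, mul_assoc]
    simp only [hfreal]
  have hint : ∀ i, IntervalIntegrable (fun s => G i j * (Real.exp (G j j * (y - s)) *
      stayProb Pr q κ ξ J E n s i (v - κ j * (y - s)))) volume 0 y := fun i =>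
    ((hsrc.intervalIntegrable hy i v (κ j)).continuousOn_mul (by fun_prop)).const_mul _
  have hexp : ∀ s, Real.exp (G j j * (y - s)) * ∑ i ∈ Finset.univ.erase j,
      G i j * stayProb Pr q κ ξ J E n s i (v - κ j * (y - s)) =
      ∑ i ∈ Finset.univ.erase j, G i j * (Real.exp (G j j * (y - s)) *
      stayProb Pr q κ ξ J E n s i (v - κ j * (y - s))) := fun s => by
    rw [Finset.mul_sum]
    exact Finset.sum_congr rfl fun i _ => by ring
  simp only [hexp]
  rw [intervalIntegral.integral_finsetSum fun i _ => hint i,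
    ← Finset.add_sum_erase _ _ (Finset.mem_univ j), hterm, hQd, zero_mul, zero_mul, zero_add]
  refine Finset.sum_congr rfl fun i hi => ?_
  rw [hterm, intervalIntegral.integral_const_mul, ← hQ i j (Finset.ne_of_mem_erase hi)]

end

/-! ### The law at a given in-out fluid -/

section

variable {S : Type*} {Ω : Type*}

/-- Consecutive in-out fluids at the jumps of the phase are increasing along a path. -/
theorem markedState_fst_mono {q κ : S → ℝ} (hq : ∀ i, 0 < q i) {ξ : Ω → ℝ × ℝ} {J : ℕ → Ω → S}
    {E : ℕ → Ω → ℝ} {ω : Ω} (hE : ∀ n, 0 < E n ω) :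
    Monotone fun n => (markedState (fluidStep q κ) ξ J E n ω).1 :=
  monotone_nat_of_le_succ fun n => by
    change _ ≤ _ + E n ω / q (J n ω)
    exact le_add_of_nonneg_right (div_nonneg (hE n).le (hq _).le)

variable [MeasurableSpace Ω]

theorem stayProb_zero {Pr : Measure Ω} [IsFiniteMeasure Pr] (q κ : S → ℝ) {X0 : Ω → ℝ}
    (hX0 : Measurable X0) {J : ℕ → Ω → S} (E : ℕ → Ω → ℝ) {y v : ℝ} (hy : 0 ≤ y) (hv : 0 ≤ v)
    (j : S) :
    stayProb Pr q κ (fun ω => (0, X0 ω)) J E 0 y j v =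
      Real.exp (-(q j * y)) * Pr.real {ω | J 0 ω = j ∧ X0 ω ≤ v - κ j * y} := by
  have hξ : Measurable fun ω => ((0 : ℝ), X0 ω) := measurable_const.prodMk hX0
  have hset : MeasurableSet {ω | X0 ω ≤ v - κ j * y} := measurableSet_le hX0 measurable_const
  have hk : ∀ ω, stayKernel (q j) (κ j) y v (0, X0 ω) =
      {ω | X0 ω ≤ v - κ j * y}.indicator
        (fun _ => ENNReal.ofReal (Real.exp (-(q j * y)))) ω := by
    intro ω
    have hiff : (0 ≤ y ∧ max 0 (X0 ω + κ j * y) ≤ v) ↔ X0 ω ≤ v - κ j * y := by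
      rw [max_le_iff, le_sub_iff_add_le]
      exact ⟨fun h => h.2.2, fun h => ⟨hy, hv, h⟩⟩
    simp only [stayKernel, sub_zero, hiff, indicator, mem_ofPred_eq]
  rw [stayProb, stayMass, entranceLaw, markedState, phaseLaw,
    lintegral_map (measurable_stayKernel_right _ _ _ _) hξ]
  simp only [hk]
  rw [lintegral_indicator_const hset, Measure.restrict_apply hset, ENNReal.toReal_mul,
    ENNReal.toReal_ofReal (Real.exp_pos _).le, Measure.real, inter_comm]
  rfl

theorem hasSum_measureReal_iUnion {Pr : Measure Ω} [IsFiniteMeasure Pr] {A : ℕ → Set Ω}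
    (hd : Pairwise (Function.onFun (AEDisjoint Pr) A)) (hm : ∀ n, MeasurableSet (A n)) :
    HasSum (fun n => Pr.real (A n)) (Pr.real (⋃ n, A n)) := by
  have h := measure_iUnion₀ hd fun n => (hm n).nullMeasurableSet
  have h2 := ENNReal.hasSum_toReal (f := fun n => Pr (A n)) (h ▸ measure_ne_top _ _)
  rwa [← ENNReal.tsum_toReal_eq fun n => measure_ne_top _ _, ← h] at h2

variable [Fintype S]

/-- The probability that a stay is in progress at in-out fluid `y`, with phase `j` and level at most
`v`, is `stayProb`. -/
theorem measureReal_stay {Pr : Measure Ω} [IsFiniteMeasure Pr] {Q : Matrix S S ℝ} {q κ : S → ℝ}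
    (hq : ∀ i, 0 ≤ q i) {ξ : Ω → ℝ × ℝ} {J : ℕ → Ω → S} {E : ℕ → Ω → ℝ}
    (h : IsMarkedChain Pr Q ξ J E) (n : ℕ) (y : ℝ) (j : S) (v : ℝ) :
    Pr.real {ω | (((markedState (fluidStep q κ) ξ J E n ω).1 ≤ y ∧
        max 0 ((markedState (fluidStep q κ) ξ J E n ω).2 +
          κ j * (y - (markedState (fluidStep q κ) ξ J E n ω).1)) ≤ v) ∧
        q j * (y - (markedState (fluidStep q κ) ξ J E n ω).1) < E n ω) ∧ J n ω = j} =
      stayProb Pr q κ ξ J E n y j v := by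
  rw [stayProb, ← prod_expMeasure_stay _ (hq j), entranceLaw,
    ← h.measure_markedState_mark (measurable_fluidStep q κ) n j
      (measurableSet_stay (q j) (κ j) y v)]
  rfl

theorem measurableSet_stay_event {Pr : Measure Ω} [IsFiniteMeasure Pr] {Q : Matrix S S ℝ}
    {q κ : S → ℝ} {ξ : Ω → ℝ × ℝ} {J : ℕ → Ω → S} {E : ℕ → Ω → ℝ}
    (h : IsMarkedChain Pr Q ξ J E) (n : ℕ) (y : ℝ) (j : S) (v : ℝ) :
    MeasurableSet {ω | (((markedState (fluidStep q κ) ξ J E n ω).1 ≤ y ∧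
        max 0 ((markedState (fluidStep q κ) ξ J E n ω).2 +
          κ j * (y - (markedState (fluidStep q κ) ξ J E n ω).1)) ≤ v) ∧
        q j * (y - (markedState (fluidStep q κ) ξ J E n ω).1) < E n ω) ∧ J n ω = j} :=
  (((h.measurable_markedState (measurable_fluidStep q κ) n).prodMk (h.measurable_mark n))
    (measurableSet_stay (q j) (κ j) y v)).inter (h.measurableSet_phase n j)

variable [DecidableEq S]

/-- If the closed formula is a distribution function at in-out fluid `0` and has no atom at `0` in
the up-phases, it is the sum over `n` of the probabilities of being in the `n`-th visited phase. -/
theorem hasSum_stayProb {Pr : Measure Ω} [IsFiniteMeasure Pr] {Q G : Matrix S S ℝ}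
    {κ : S → ℝ} {X0 : Ω → ℝ} {J : ℕ → Ω → S} {E : ℕ → Ω → ℝ}
    (h : IsMarkedChain Pr Q (fun ω => ((0 : ℝ), X0 ω)) J E) (hX0 : Measurable X0)
    (hQ0 : ∀ i j, 0 ≤ Q i j) (hQd : ∀ i, Q i i = 0) (hGneg : ∀ i, G i i < 0)
    (hG : ∀ i j, i ≠ j → 0 ≤ G i j) (hQ : ∀ i j, i ≠ j → Q i j * -G i i = G i j)
    {lam : ℝ} (hlam : 0 < lam) {a b : S → ℝ}
    (hzero : ∀ y j, 0 < κ j → levelLaw G κ lam a b y j 0 = 0)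
    (hinit : ∀ j w, Pr.real {ω | J 0 ω = j ∧ X0 ω ≤ w} = levelCdf G κ lam a b 0 j w)
    {y : ℝ} (hy : 0 ≤ y) (j : S) (v : ℝ) :
    HasSum (fun n => stayProb Pr (fun i => -G i i) κ (fun ω => (0, X0 ω)) J E n y j v)
      (levelCdf G κ lam a b y j v) := by
  have hq : ∀ i, 0 < -G i i := fun i => neg_pos.2 (hGneg i)
  have hsrc : IsForwardSource (levelCdf G κ lam a b) :=
    ⟨measurable_levelCdf G κ lam a b, exists_abs_levelCdf_le G κ hlam a b⟩
  refine hasSum_forward_iterates hG (fun j => (hGneg j).le) κ hsrc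
    (fun n => isForwardSource_stayProb Pr (fun i => (hq i).le) κ _ J E n)
    (fun _ _ _ _ => ENNReal.toReal_nonneg) (fun y j v hv => if_neg (not_le.2 hv))
    (fun n y j v hv => by rw [stayProb, stayMass_of_neg _ _ _ _ hv, ENNReal.toReal_zero])
    (fun y j v hy hv => ?_) (fun n y j v hy hv => ?_) hy j v
  · rw [stayProb_zero _ κ hX0 E hy hv, hinit, neg_mul, neg_neg]
    exact levelCdf_forward_equation hzero hy hv j
  · refine stayProb_succ h hQ0 hQd hGneg hQ ?_ hy hv j
    filter_upwards [h.ae_mark_pos] with ω hω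
    exact markedState_fst_mono (κ := κ) (ξ := fun ω => ((0 : ℝ), X0 ω)) (J := J) hq hω
      (Nat.zero_le n)

/-- If all phases have a positive exit rate, the closed formula is the law of the phase and the
level at in-out fluid `y`. That almost every path reaches `y` needs no separate
argument, since the formula has total mass one. -/
theorem measureReal_eq_levelCdf {Pr : Measure Ω} [IsProbabilityMeasure Pr] {Q G : Matrix S S ℝ}
    {κ : S → ℝ} {X0 : Ω → ℝ} {J : ℕ → Ω → S} {E : ℕ → Ω → ℝ}
    (h : IsMarkedChain Pr Q (fun ω => ((0 : ℝ), X0 ω)) J E) (hX0 : Measurable X0)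
    (hQ0 : ∀ i j, 0 ≤ Q i j) (hQd : ∀ i, Q i i = 0) (hGneg : ∀ i, G i i < 0)
    (hG : ∀ i j, i ≠ j → 0 ≤ G i j) (hGsum : ∀ i, ∑ j, G i j = 0)
    (hQ : ∀ i j, i ≠ j → Q i j * -G i i = G i j)
    {lam : ℝ} (hlam : 0 < lam) {a b : S → ℝ} (ha : ∑ j, a j = 1)
    (hzero : ∀ y j, 0 < κ j → levelLaw G κ lam a b y j 0 = 0)
    (hinit : ∀ j w, Pr.real {ω | J 0 ω = j ∧ X0 ω ≤ w} = levelCdf G κ lam a b 0 j w)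
    {y : ℝ} (hy : 0 ≤ y) (j : S) (v : ℝ) {A : Set Ω} {x : ℕ → Ω → ℝ × ℝ}
    (hx : x = markedState (fluidStep (fun i => -G i i) κ) (fun ω => ((0 : ℝ), X0 ω)) J E)
    (hA : ∀ᵐ ω ∂Pr, ∀ n, (x n ω).1 ≤ y → -G (J n ω) (J n ω) * (y - (x n ω).1) < E n ω →
      (ω ∈ A ↔ J n ω = j ∧ max 0 ((x n ω).2 + κ (J n ω) * (y - (x n ω).1)) ≤ v)) :
    Pr.real A = levelCdf G κ lam a b y j v := by
  have hq : ∀ i, 0 < -G i i := fun i => neg_pos.2 (hGneg i)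
  set B : S → ℝ → ℕ → Set Ω := fun i w n => {ω | (((x n ω).1 ≤ y ∧
    max 0 ((x n ω).2 + κ i * (y - (x n ω).1)) ≤ w) ∧ -G i i * (y - (x n ω).1) < E n ω) ∧
      J n ω = i} with hB
  set N : ℕ → Set Ω := fun n => {ω | (x n ω).1 ≤ y ∧
    -G (J n ω) (J n ω) * (y - (x n ω).1) < E n ω} with hN
  have hBm : ∀ i w n, MeasurableSet (B i w n) := fun i w n => by
    have := measurableSet_stay_event (q := fun i => -G i i) (κ := κ) h n y i w
    rwa [← hx] at this
  have hBp : ∀ i w n, Pr.real (B i w n) =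
      stayProb Pr (fun i => -G i i) κ (fun ω => (0, X0 ω)) J E n y i w := fun i w n => by
    have := measureReal_stay (κ := κ) (fun i => (hq i).le) h n y i w
    rwa [← hx] at this
  have hxm : ∀ n, Measurable (x n) := fun n => by
    rw [hx]
    exact h.measurable_markedState (measurable_fluidStep _ κ) n
  have hNm : ∀ n, MeasurableSet (N n) := by
    intro n
    have : N n = ⋃ i, ({ω | (x n ω).1 ≤ y} ∩ {ω | -G i i * (y - (x n ω).1) < E n ω}) ∩
        {ω | J n ω = i} := by
      ext ω
      simp [hN]
    rw [this]
    have hEm := h.measurable_mark n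
    have hx1 := (hxm n).fst
    refine MeasurableSet.iUnion fun i => MeasurableSet.inter (MeasurableSet.inter ?_ ?_)
      (h.measurableSet_phase n i)
    · exact measurableSet_le hx1 measurable_const
    · exact measurableSet_lt ((measurable_const.sub hx1).const_mul _) hEm
  have hBN : ∀ i w n, B i w n ⊆ N n := by
    rintro i w n ω ⟨⟨⟨h1, _⟩, h2⟩, rfl⟩
    exact ⟨h1, h2⟩
  have hdisj : Pairwise (Function.onFun (AEDisjoint Pr) N) := by
    have key : ∀ m n, m < n → AEDisjoint Pr (N m) (N n) := by
      intro m n hmn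
      refine measure_eq_zero_iff_ae_notMem.2 ?_
      filter_upwards [h.ae_mark_pos] with ω hω hmem
      have hmono := markedState_fst_mono (κ := κ) (ξ := fun ω => ((0 : ℝ), X0 ω)) (J := J) hq hω
        (Nat.succ_le_of_lt hmn)
      rw [← hx] at hmono
      have hstep : (x (m + 1) ω).1 = (x m ω).1 + E m ω / -G (J m ω) (J m ω) := by
        rw [hx]
        rfl
      have h1 : y - (x m ω).1 < E m ω / -G (J m ω) (J m ω) := by
        rw [lt_div_iff₀ (hq _), mul_comm]
        exact hmem.1.2
      have h2 : (x n ω).1 ≤ y := hmem.2.1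
      simp only [Nat.succ_eq_add_one] at hmono
      linarith
    intro m n hmn
    rcases lt_or_gt_of_ne hmn with h' | h'
    · exact key m n h'
    · exact (key n m h').symm
  have hcdf := fun i w => hasSum_stayProb h hX0 hQ0 hQd hGneg hG hQ hlam hzero hinit hy i w
  have hNsum := hasSum_measureReal_iUnion hdisj hNm
  -- the union of the `N n` has at least the mass that the formula gives to the levels up to `w`
  have hmass : ∀ w, ∑ i, levelCdf G κ lam a b y i w ≤ Pr.real (⋃ n, N n) := by
    intro w
    refine hasSum_le (fun n => ?_) (hasSum_sum fun i (_ : i ∈ Finset.univ) => hcdf i w) hNsum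
    simp only [← hBp]
    rw [← measureReal_biUnion_finset _ fun i _ => hBm i w n]
    · exact measureReal_mono (iUnion₂_subset fun i _ => hBN i w n)
    · intro i _ k _ hik
      exact Set.disjoint_left.2 fun ω h1 h2 => hik (h1.2.symm.trans h2.2)
  have hlim : Tendsto (fun w => ∑ i, levelCdf G κ lam a b y i w) atTop (𝓝 1) := by
    rw [← ha, ← sum_vecMul_exp_smul hGsum a y]
    refine tendsto_finsetSum _ fun i _ => ?_
    have hexp : Tendsto (fun w : ℝ => Real.exp (-lam * w)) atTop (𝓝 0) := by
      refine Real.tendsto_exp_atBot.comp ?_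
      exact tendsto_id.const_mul_atTop_of_neg (neg_neg_of_pos hlam)
    have h1 := (hexp.mul_const
      ((b ᵥ* NormedSpace.exp (y • (G + lam • Matrix.diagonal κ))) i)).const_sub
        ((a ᵥ* NormedSpace.exp (y • G)) i)
    rw [zero_mul, sub_zero] at h1
    refine h1.congr' ?_
    filter_upwards [eventually_ge_atTop 0] with w hw
    rw [levelCdf, if_pos hw, levelLaw]
  have hone : Pr (⋃ n, N n) = 1 := by
    have h1 : 1 ≤ Pr.real (⋃ n, N n) := le_of_tendsto' hlim fun w => hmass w
    have h2 : Pr.real (⋃ n, N n) = 1 := le_antisymm measureReal_le_one h1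
    rw [← ofReal_measureReal, h2, ENNReal.ofReal_one]
  have hae : ∀ᵐ ω ∂Pr, ω ∈ ⋃ n, N n :=
    (mem_ae_iff_prob_eq_one (MeasurableSet.iUnion hNm)).2 hone
  have hAeq : A =ᵐ[Pr] ⋃ n, B j v n := by
    filter_upwards [hae, hA] with ω hω hAω
    refine propext ?_
    change ω ∈ A ↔ ω ∈ ⋃ n, B j v n
    rw [mem_iUnion] at hω ⊢
    constructor
    · intro hmem
      obtain ⟨n, h1, h2⟩ := hω
      obtain ⟨h3, h4⟩ := (hAω n h1 h2).1 hmem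
      subst h3
      exact ⟨n, ⟨⟨h1, h4⟩, h2⟩, rfl⟩
    · rintro ⟨n, ⟨⟨h1, h4⟩, h2⟩, h3⟩
      subst h3
      exact (hAω n h1 h2).2 ⟨rfl, h4⟩
  rw [measureReal_congr hAeq]
  have h1 := hasSum_measureReal_iUnion (Pr := Pr) (A := B j v)
    (fun m n hmn => (hdisj hmn).mono (hBN j v m) (hBN j v n)) (hBm j v)
  simp only [hBp] at h1
  exact h1.unique (hcdf j v)

end

/-! ### The exponential initial law -/

section

variable {S : Type*}

theorem expDensity_nonneg {lam : ℝ} (hlam : 0 < lam) {p : S → ℝ} {i : S} (hp : 0 ≤ p i) (x : ℝ) :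
    0 ≤ expDensity lam p i x :=
  mul_nonneg (mul_nonneg hp hlam.le) (Real.exp_pos _).le

theorem integrableOn_expDensity {lam : ℝ} (hlam : 0 < lam) (p : S → ℝ) (i : S) :
    IntegrableOn (expDensity lam p i) (Ioi 0) :=
  (integrableOn_exp_mul_Ioi (neg_neg_of_pos hlam) 0).const_mul _

theorem integral_Ioi_expDensity {lam : ℝ} (hlam : 0 < lam) (p : S → ℝ) (i : S) (v : ℝ) :
    ∫ x in Ioi v, expDensity lam p i x = Real.exp (-lam * v) * p i := by
  have h := integral_exp_mul_Ioi (neg_neg_of_pos hlam) v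
  simp only [expDensity]
  rw [integral_const_mul, h]
  field_simp

theorem integral_expDensity {lam : ℝ} (hlam : 0 < lam) (p : S → ℝ) (i : S) {v : ℝ} (hv : 0 ≤ v) :
    ∫ x in (0 : ℝ)..v, expDensity lam p i x = p i - Real.exp (-lam * v) * p i := by
  have h := integral_Ioi_expDensity hlam p i
  have hadd := setIntegral_union (μ := volume) (f := expDensity lam p i)
    (Ioc_disjoint_Ioi (le_refl v) : Disjoint (Ioc 0 v) (Ioi v)) measurableSet_Ioi
    ((integrableOn_expDensity hlam p i).mono_set Ioc_subset_Ioi_self)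
    ((integrableOn_expDensity hlam p i).mono_set (Ioi_subset_Ioi hv))
  rw [Ioc_union_Ioi_eq_Ioi hv, h, h, mul_zero, Real.exp_zero, one_mul] at hadd
  rw [intervalIntegral.integral_of_le hv]
  linarith

theorem initialMeasure_real_apply {lam : ℝ} (hlam : 0 < lam) {p P : S → ℝ} {i : S} (hp : 0 ≤ p i)
    (hP : 0 ≤ P i) {A : Set ℝ} (hA : MeasurableSet A) :
    (initialMeasure lam p P i).real A =
      (∫ x in A ∩ Ioi 0, expDensity lam p i x) + P i * A.indicator 1 0 := by
  have hint : IntegrableOn (expDensity lam p i) (A ∩ Ioi 0) :=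
    (integrableOn_expDensity hlam p i).mono_set inter_subset_right
  have h0 : 0 ≤ ∫ x in A ∩ Ioi 0, expDensity lam p i x :=
    integral_nonneg fun x => expDensity_nonneg hlam hp x
  have h1 : initialMeasure lam p P i A =
      ENNReal.ofReal (∫ x in A ∩ Ioi 0, expDensity lam p i x) +
        ENNReal.ofReal (P i) * A.indicator 1 0 := by
    rw [initialMeasure, Measure.add_apply, withDensity_apply _ hA, Measure.restrict_restrict hA,
      Measure.smul_apply, Measure.dirac_apply' _ hA, smul_eq_mul,
      ofReal_integral_eq_lintegral_ofReal hint
        (ae_of_all _ fun x => expDensity_nonneg hlam hp x)]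
  rw [Measure.real, h1, ENNReal.toReal_add ENNReal.ofReal_ne_top, ENNReal.toReal_ofReal h0,
    ENNReal.toReal_mul, ENNReal.toReal_ofReal hP]
  · by_cases h : (0 : ℝ) ∈ A <;> simp [h]
  · refine ENNReal.mul_ne_top ENNReal.ofReal_ne_top ?_
    by_cases h : (0 : ℝ) ∈ A <;> simp [h]

theorem initialMeasure_real_Iic {lam : ℝ} (hlam : 0 < lam) {p P : S → ℝ} {i : S} (hp : 0 ≤ p i)
    (hP : 0 ≤ P i) (w : ℝ) :
    (initialMeasure lam p P i).real (Iic w) =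
      if 0 ≤ w then p i + P i - Real.exp (-lam * w) * p i else 0 := by
  rw [initialMeasure_real_apply hlam hp hP measurableSet_Iic, inter_comm, Ioi_inter_Iic]
  split_ifs with hw
  · rw [← intervalIntegral.integral_of_le hw, integral_expDensity hlam p i hw,
      indicator_of_mem (mem_Iic.2 hw), Pi.one_apply]
    ring
  · rw [Ioc_eq_empty fun h => hw h.le, setIntegral_empty,
      indicator_of_notMem (notMem_Iic.2 (not_le.1 hw))]
    ring

theorem initialMeasure_real_Icc {lam : ℝ} (hlam : 0 < lam) {p P : S → ℝ} {i : S} (hp : 0 ≤ p i)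
    (hP : 0 ≤ P i) {v : ℝ} (hv : 0 < v) :
    (initialMeasure lam p P i).real (Icc 0 v) = p i + P i - Real.exp (-lam * v) * p i := by
  have h : Icc 0 v ∩ Ioi 0 = Ioc 0 v := by
    ext x
    simp only [mem_inter_iff, mem_Icc, mem_Ioi, mem_Ioc]
    exact ⟨fun h => ⟨h.2, h.1.2⟩, fun h => ⟨⟨h.1.le, h.2⟩, h.1⟩⟩
  rw [initialMeasure_real_apply hlam hp hP measurableSet_Icc, h,
    ← intervalIntegral.integral_of_le hv.le, integral_expDensity hlam p i hv.le,
    indicator_of_mem (left_mem_Icc.2 hv.le), Pi.one_apply]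
  ring

theorem initialMeasure_real_Ioi {lam : ℝ} (hlam : 0 < lam) {p P : S → ℝ} {i : S} (hp : 0 ≤ p i)
    (hP : 0 ≤ P i) {v : ℝ} (hv : 0 < v) :
    (initialMeasure lam p P i).real (Ioi v) = Real.exp (-lam * v) * p i := by
  rw [initialMeasure_real_apply hlam hp hP measurableSet_Ioi,
    inter_eq_left.2 (Ioi_subset_Ioi hv.le), integral_Ioi_expDensity hlam,
    indicator_of_notMem (notMem_Ioi.2 hv.le)]
  ring

theorem initialMeasure_real_Ici {lam : ℝ} (hlam : 0 < lam) {p P : S → ℝ} {i : S} (hp : 0 ≤ p i)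
    (hP : 0 ≤ P i) : (initialMeasure lam p P i).real (Ici 0) = p i + P i := by
  rw [initialMeasure_real_apply hlam hp hP measurableSet_Ici,
    inter_eq_right.2 Ioi_subset_Ici_self, integral_Ioi_expDensity hlam,
    indicator_of_mem self_mem_Ici, mul_zero, Real.exp_zero, Pi.one_apply]
  ring

theorem initialMeasure_real_univ {lam : ℝ} (hlam : 0 < lam) {p P : S → ℝ} {i : S} (hp : 0 ≤ p i)
    (hP : 0 ≤ P i) : (initialMeasure lam p P i).real univ = p i + P i := by
  rw [initialMeasure_real_apply hlam hp hP MeasurableSet.univ, univ_inter,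
    integral_Ioi_expDensity hlam, indicator_of_mem (mem_univ _), mul_zero, Real.exp_zero,
    Pi.one_apply]
  ring

variable [Fintype S] [DecidableEq S]

theorem lawFormula_eq_levelLaw (T : Matrix S S ℝ) (c : S → ℝ) {r : S → ℝ} (hr : ∀ i, r i ≠ 0)
    {lam : ℝ} (hlam : 0 < lam) {p P : S → ℝ} (hp : ∀ i, 0 ≤ p i) (hP : ∀ i, 0 ≤ P i) (y : ℝ)
    {v : ℝ} (hv : 0 < v) (j : S) :
    lawFormula T c r lam (initialMeasure lam p P) y v j =
      levelLaw (fluidGenerator T r) (fun i => c i / |r i|) lam (fun i => p i + P i) p y j v := by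
  have h1 : (fun i => (initialMeasure lam p P i).real (Ioi v)) = Real.exp (-lam * v) • p :=
    funext fun i => initialMeasure_real_Ioi hlam (hp i) (hP i) hv
  have h2 : (fun i => (initialMeasure lam p P i).real (Ici 0)) = fun i => p i + P i :=
    funext fun i => initialMeasure_real_Ici hlam (hp i) (hP i)
  rw [lawFormula, h1, h2, levelLaw, scaledDrift_eq c hr, Matrix.smul_vecMul, Pi.add_apply,
    Pi.neg_apply, Pi.smul_apply, smul_eq_mul]
  ring

/-! ### The generator and its jump chain -/

theorem IsGenerator.diag_nonpos {T : Matrix S S ℝ} (hT : IsGenerator T) (i : S) : T i i ≤ 0 := by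
  have h := hT.2 i
  rw [← Finset.add_sum_erase _ _ (Finset.mem_univ i)] at h
  have : 0 ≤ ∑ j ∈ Finset.univ.erase i, T i j :=
    Finset.sum_nonneg fun j hj => hT.1 i j (Finset.ne_of_mem_erase hj).symm
  linarith

/-- In an irreducible chain an absorbing phase is the only phase. -/
theorem diag_neg_or_subsingleton {T : Matrix S S ℝ} (hT : IsGenerator T)
    (hirr : IsIrreducibleGenerator T) : (∀ i, T i i < 0) ∨ Subsingleton S := by
  by_contra! h
  obtain ⟨⟨i, hi⟩, hS⟩ := h
  obtain ⟨j, hj⟩ := exists_ne i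
  have hii : T i i = 0 := le_antisymm (hT.diag_nonpos i) hi
  obtain h0 | ⟨k, ⟨hik, hpos⟩, _⟩ := (hirr i j).cases_head
  · exact hj h0.symm
  · have h := hT.2 i
    rw [← Finset.add_sum_erase _ _ (Finset.mem_univ i), hii, zero_add,
      Finset.sum_eq_zero_iff_of_nonneg
        fun j hj => hT.1 i j (Finset.ne_of_mem_erase hj).symm] at h
    exact hpos.ne' (h k (Finset.mem_erase.2 ⟨hik.symm, Finset.mem_univ k⟩))

end

end FluidFluid

open FluidFluid in
theorem theorem1 {S : Type*} [Fintype S] [DecidableEq S]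
    (T : Matrix S S ℝ) (hT : IsGenerator T) (hirr : IsIrreducibleGenerator T)
    (c r : S → ℝ) (hc : ∀ i, c i ≠ 0) (hr : ∀ i, r i ≠ 0)
    (lam : ℝ) (hlam : 0 < lam)
    (p P : S → ℝ) (hp : ∀ i, 0 ≤ p i ∧ p i ≤ 1)
    (hP : ∀ i, 0 ≤ P i) (hPplus : ∀ i, 0 < c i → P i = 0)
    (μ : S → Measure ℝ) (hμ : μ = initialMeasure lam p P)
    (hbc : ∀ n : ℕ,
      BoundaryCondition T c r ((opD T c r)^[n] (fun j v => (μ j).real (Icc 0 v))))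
    {Ω : Type*} [MeasurableSpace Ω] (Pr : Measure Ω) [IsProbabilityMeasure Pr]
    (φ : ℝ → Ω → S) (X : ℝ → Ω → ℝ)
    (hX0 : Measurable (X 0))
    (hφ : IsCTMC Pr T (X 0) φ)
    (hX : ∀ᵐ ω ∂Pr, IsFluidLevel c (fun t => φ t ω) (fun t => X t ω))
    (hinit : ∀ (i : S) (A : Set ℝ), MeasurableSet A →
      Pr {ω | φ 0 ω = i ∧ X 0 ω ∈ A} = μ i A) :
    (∀ (v : ℝ), 0 < v → ∀ i : S,
      (μ i).real (Ioi v) =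
        (∫ x in Ioi (0 : ℝ), expDensity lam p i x) - (∫ x in (0 : ℝ)..v, expDensity lam p i x) ∧
      (μ i).real (Ioi v) = Real.exp (-lam * v) * (expDensity lam p i 0 / lam)) ∧
    ∀ (y : ℝ), 0 < y → ∀ (v : ℝ), 0 < v → ∀ j : S,
      HasSum (fun n : ℕ => y ^ n / (n.factorial : ℝ) *
          (opD T c r)^[n] (fun k w => (μ k).real (Icc 0 w)) j v)
        (lawFormula T c r lam μ y v j) ∧
      Pr.real {ω | φ (inOutTime r (fun t => φ t ω) y) ω = j ∧
          X (inOutTime r (fun t => φ t ω) y) ω ∈ Icc 0 v} =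
        lawFormula T c r lam μ y v j := by
  subst hμ
  have hp0 : ∀ i, 0 ≤ p i := fun i => (hp i).1
  refine ⟨fun v hv i => ?_, fun y hy v hv j => ?_⟩
  · rw [initialMeasure_real_Ioi hlam (hp0 i) (hP i) hv, integral_Ioi_expDensity hlam,
      integral_expDensity hlam p i hv.le, expDensity, mul_zero, Real.exp_zero]
    refine ⟨by ring, ?_⟩
    field_simp
  · set a : S → ℝ := fun i => p i + P i with ha
    set G := fluidGenerator T r with hGdef
    set κ : S → ℝ := fun i => c i / |r i| with hκ
    have hrpos : ∀ i, 0 < |r i| := fun i => abs_pos.2 (hr i)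
    have hGapp : ∀ i j, G i j = T i j / |r i| := fluidGenerator_apply T hr
    have hF : ∀ j v, 0 < v → (initialMeasure lam p P j).real (Icc 0 v) =
        a j - Real.exp (-lam * v) * p j := fun j v hv =>
      initialMeasure_real_Icc hlam (hp0 j) (hP j) hv
    rw [lawFormula_eq_levelLaw T c hr hlam hp0 hP y hv j]
    refine ⟨hasSum_opD_iterate T c hr lam a p hF y j hv, ?_⟩
    have hzero : ∀ y j, 0 < κ j → levelLaw G κ lam a p y j 0 = 0 := fun y j hj =>
      levelLaw_zero_eq_zero T hc hr lam a p hF hbc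
        (fun i hi => by rw [ha]; simp [hPplus i hi]) y ((div_pos_iff_of_pos_right (hrpos j)).1 hj)
    obtain ⟨J, E, hJm, hEm, hlaw, hpath⟩ := hφ
    set ξ : Ω → ℝ × ℝ := fun ω => (0, X 0 ω) with hξ
    have hchain : IsMarkedChain Pr (jumpMatrix T) ξ J E := by
      refine ⟨measurable_const.prodMk hX0, hJm, hEm, fun n s A B hA hB => ?_⟩
      exact hlaw n s ((fun x => ((0 : ℝ), x)) ⁻¹' A) B
        ((by fun_prop : Measurable fun x : ℝ => ((0 : ℝ), x)) hA) hB
    have hEpos := hchain.ae_mark_pos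
    have hphase0 : ∀ᵐ ω ∂Pr, φ 0 ω = J 0 ω := by
      filter_upwards [hEpos, hpath] with ω hω hpω
      refine hpω 0 0 le_rfl (by simp [jumpTime]) ?_
      rw [ENNReal.ofReal_zero, jumpTime, Finset.sum_range_one]
      exact ENNReal.div_pos (ENNReal.ofReal_pos.2 (hω 0)).ne' ENNReal.ofReal_ne_top
    have hstart : ∀ i A, MeasurableSet A →
        Pr {ω | J 0 ω = i ∧ X 0 ω ∈ A} = initialMeasure lam p P i A := fun i A hA => by
      rw [← hinit i A hA]
      refine measure_congr ?_
      filter_upwards [hphase0] with ω hω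
      refine propext ?_
      change (J 0 ω = i ∧ X 0 ω ∈ A) ↔ (φ 0 ω = i ∧ X 0 ω ∈ A)
      rw [hω]
    have hlevel0 : ∀ j w, Pr.real {ω | J 0 ω = j ∧ X 0 ω ≤ w} = levelCdf G κ lam a p 0 j w := by
      intro j w
      have h1 := congrArg ENNReal.toReal (hstart j (Iic w) measurableSet_Iic)
      have h2 := initialMeasure_real_Iic hlam (hp0 j) (hP j) w
      refine h1.trans (h2.trans ?_)
      simp [levelCdf, levelLaw, ha]
    have hmass : ∑ i, a i = 1 := by
      have h1 : ∀ i, a i = (Pr {ω | J 0 ω = i}).toReal := fun i => by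
        have := congrArg ENNReal.toReal (hstart i univ MeasurableSet.univ)
        simp only [mem_univ, and_true] at this
        rw [this]
        exact (initialMeasure_real_univ hlam (hp0 i) (hP i)).symm
      have h2 := measure_eq_sum_fibres Pr (hJm 0) univ
      simp only [inter_univ, measure_univ] at h2
      simp only [h1]
      rw [← ENNReal.toReal_sum fun i _ => measure_ne_top _ _, ← h2, ENNReal.toReal_one]
    set A : Set Ω := {ω | φ (inOutTime r (fun t => φ t ω) y) ω = j ∧
          X (inOutTime r (fun t => φ t ω) y) ω ∈ Icc 0 v} with hA
    set q : S → ℝ := fun i => -G i i with hq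
    set x := markedState (fluidStep q κ) ξ J E with hx
    -- whenever `y` is reached in the `n`-th stay, the path is read off the marked chain
    have hread : ∀ᵐ ω ∂Pr, ∀ n, (∀ k < n, T (J k ω) (J k ω) ≠ 0) → (x n ω).1 ≤ y →
        -G (J n ω) (J n ω) * (y - (x n ω).1) < E n ω →
        (ω ∈ A ↔ J n ω = j ∧ max 0 ((x n ω).2 + κ (J n ω) * (y - (x n ω).1)) ≤ v) := by
      filter_upwards [hEpos, hpath, hX] with ω hω hpω hXω n hn h1 h2
      have hqe : q = fun i => -T i i / |r i| := funext fun i => by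
        rw [hq]
        simp only [hGapp]
        ring
      obtain ⟨h3, h4⟩ := phase_level_at_inOutTime hr hT.diag_nonpos hω hpω hXω
        (x := fun n => x n ω) rfl (fun k => by rw [← hqe]; rfl) hn hy h1
        (by rw [hGapp, ← neg_div] at h2; exact h2)
      rw [hA, mem_ofPred_eq, h3, h4, mem_Icc, and_iff_right (le_max_left _ _)]
    have hfin : Pr.real A = levelCdf G κ lam a p y j v := by
      rcases diag_neg_or_subsingleton hT hirr with hneg | hsub
      · have hGneg : ∀ i, G i i < 0 := fun i => by
          rw [hGapp]
          exact div_neg_of_neg_of_pos (hneg i) (hrpos i)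
        have hjump : ∀ i j, i ≠ j → jumpMatrix T i j = T i j / -T i i := fun i j hij => by
          rw [jumpMatrix, if_neg (hneg i).ne, if_neg hij]
        have hdiag : ∀ i, jumpMatrix T i i = 0 := fun i => by
          rw [jumpMatrix, if_neg (hneg i).ne, if_pos rfl]
        refine measureReal_eq_levelCdf hchain hX0 (fun i j => ?_) hdiag hGneg (fun i j hij => ?_)
          (fun i => ?_) (fun i j hij => ?_) hlam hmass hzero hlevel0 hy.le j v hx ?_
        · rcases eq_or_ne i j with rfl | hij
          · exact (hdiag i).ge
          · rw [hjump i j hij]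
            exact div_nonneg (hT.1 i j hij) (neg_nonneg.2 (hneg i).le)
        · rw [hGapp]
          exact div_nonneg (hT.1 i j hij) (hrpos i).le
        · simp only [hGapp]
          rw [← Finset.sum_div, hT.2, zero_div]
        · rw [hjump i j hij, hGapp, hGapp]
          have := (hneg i).ne
          have := (hrpos i).ne'
          field_simp
        · filter_upwards [hread] with ω hω n
          exact hω n fun k _ => (hneg _).ne
      · -- a single phase: the generator vanishes and the first stay lasts for ever
        have hT0 : ∀ i, T i i = 0 := fun i => by
          have := hT.2 i
          rwa [Fintype.sum_subsingleton _ i] at this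
        have hG0 : ∀ i, G i i = 0 := fun i => by rw [hGapp, hT0, zero_div]
        have hAeq : A =ᵐ[Pr] {ω | J 0 ω = j ∧ X 0 ω ≤ v - κ j * y} := by
          filter_upwards [hread, hEpos] with ω hω hEω
          refine propext ((hω 0 (fun k hk => absurd hk (Nat.not_lt_zero k)) hy.le ?_).trans ?_)
          · rw [hG0, neg_zero, zero_mul]
            exact hEω 0
          · change (J 0 ω = j ∧ max 0 (X 0 ω + κ (J 0 ω) * (y - 0)) ≤ v) ↔
              (J 0 ω = j ∧ X 0 ω ≤ v - κ j * y)
            refine and_congr_right fun h0 => ?_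
            rw [h0, sub_zero, max_le_iff, le_sub_iff_add_le, and_iff_right hv.le]
        have herase : Finset.univ.erase j = ∅ :=
          Finset.eq_empty_of_forall_notMem fun i hi =>
            Finset.ne_of_mem_erase hi (Subsingleton.elim i j)
        rw [measureReal_congr hAeq, hlevel0, levelCdf_forward_equation hzero hy.le hv.le j, herase]
        simp [hG0]
    rw [hfin, levelCdf, if_pos hv.le]
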